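/- Let $\Bbbk$ be an algebraically closed field of characteristic zero, let $n\ge 0$, and let $G\subset \mathrm{GL}_n(\Bbbk)$ be a finite subgroup, acting on the field of rational functions $\Bbbk(x_1,\dots,x_n)$ by $(g\cdot f)(x)=f(g^{-1}x)$. An element $\psi\in \Bbbk(x_1,\dots,x_n)\setminus \Bbbk$ is called closed if the subfield $\Bbbk(\psi)$ is algebraically closed in $\Bbbk(x_1,\dots,x_n)$, i.e. every element of $\Bbbk(x_1,\dots,x_n)$ that is algebraic over $\Bbbk(\psi)$ lies in $\Bbbk(\psi)$. A closed element $\psi$ is called generative for $\phi\in \Bbbk(x_1,\dots,x_n)\setminus\Bbbk$ if $\phi=H(\psi)$ for some $H\in \Bbbk(t)$. A subfield $\Bbbk\subseteq L\subseteq \Bbbk(x_1,\dots,x_n)$ is called saturated in $\Bbbk(x_1,\dots,x_n)$ if for every $\phi\in L\setminus \Bbbk$ it contains a generative element of $\phi$. Let $I_{120}\subset \mathrm{SL}_2(\mathbb{C})$ be the binary icosahedral group, that is, the preimage of a subgroup of $\mathrm{PSL}_2(\mathbb{C})$ isomorphic to the alternating group $A_5$ (such a subgroup is unique up to conjugation).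 Then the following conditions are equivalent: (i) $G$ has neither nontrivial abelian factor groups nor factor groups isomorphic to $I_{120}$; (ii) the subfield of invariants $\Bbbk(x_1,\dots,x_n)^{G}$ is saturated in $\Bbbk(x_1,\dots,x_n)$. -/

import Mathlib

open scoped MatrixGroups

noncomputable section

/-- The field of rational functions `k(x_1, …, x_n)`. -/
abbrev RatFunField (k : Type*) [Field k] (n : ℕ) : Type _ :=
  FractionRing (MvPolynomial (Fin n) k)

/-- The substitution `f(x) ↦ f(A x)` on polynomials: `x_i ↦ ∑ j, A i j * x_j`. -/
def linearSubst {k : Type*} [Field k] {n : ℕ} (A : Matrix (Fin n) (Fin n) k) :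
    MvPolynomial (Fin n) k →ₐ[k] MvPolynomial (Fin n) k :=
  MvPolynomial.aeval fun i => ∑ j, MvPolynomial.C (A i j) * MvPolynomial.X j

theorem linearSubst_one {k : Type*} [Field k] {n : ℕ} :
    linearSubst (1 : Matrix (Fin n) (Fin n) k) = AlgHom.id k _ := by
  ext1 i
  simp [linearSubst, Matrix.one_apply]

theorem linearSubst_comp {k : Type*} [Field k] {n : ℕ} (A B : Matrix (Fin n) (Fin n) k) :
    (linearSubst A).comp (linearSubst B) = linearSubst (B * A) := by
  ext1 i
  simp only [linearSubst, AlgHom.comp_apply, MvPolynomial.aeval_X, map_sum, map_mul,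
    MvPolynomial.aeval_C, MvPolynomial.algebraMap_eq, Matrix.mul_apply, Finset.mul_sum,
    Finset.sum_mul]
  rw [Finset.sum_comm]
  simp only [mul_assoc]

/-- The action of `GL_n(k)` on `k[x_1, …, x_n]`, regarded as functions on the column space `k^n`:
`(g · f)(x) = f(g⁻¹ x)`. -/
def polyAction (k : Type*) [Field k] (n : ℕ) :
    GL (Fin n) k →* (MvPolynomial (Fin n) k ≃ₐ[k] MvPolynomial (Fin n) k) where
  toFun g := AlgEquiv.ofAlgHom
    (linearSubst (g⁻¹ : GL (Fin n) k).val) (linearSubst g.val)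
    (by rw [linearSubst_comp, Units.mul_inv, linearSubst_one])
    (by rw [linearSubst_comp, Units.inv_mul, linearSubst_one])
  map_one' := by
    ext1 f
    change linearSubst ((1 : GL (Fin n) k)⁻¹).val f = f
    rw [inv_one, Units.val_one, linearSubst_one]
    rfl
  map_mul' g h := by
    ext1 f
    change linearSubst ((g * h)⁻¹ : GL (Fin n) k).val f =
      ((linearSubst (g⁻¹ : GL (Fin n) k).val).comp (linearSubst (h⁻¹ : GL (Fin n) k).val)) f
    rw [linearSubst_comp, mul_inv_rev, Units.val_mul]

/-- The induced action of `GL_n(k)` on `k(x_1, …, x_n)` by field automorphisms over `k`. -/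
def ratFunAction (k : Type*) [Field k] (n : ℕ) :
    GL (Fin n) k →* (RatFunField k n ≃ₐ[k] RatFunField k n) :=
  (IsFractionRing.fieldEquivOfAlgEquivHom k (RatFunField k n)).comp (polyAction k n)

/-- The subfield of invariants `k(x_1, …, x_n)^G`. -/
def invariantSubfield {k : Type*} [Field k] {n : ℕ} (G : Subgroup (GL (Fin n) k)) :
    IntermediateField k (RatFunField k n) :=
  IntermediateField.fixedField (G.map (ratFunAction k n))

/-- A subfield `L` of `K` is algebraically closed in `K` if every element of `K` which is
algebraic over `L` belongs to `L`. -/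
def IsAlgClosedInside {k K : Type*} [Field k] [Field K] [Algebra k K]
    (L : IntermediateField k K) : Prop :=
  ∀ f : K, IsAlgebraic L f → f ∈ L

/-- `ψ ∈ K ∖ k` is closed if `k(ψ)` is algebraically closed in `K`. -/
def IsClosedElement (k : Type*) {K : Type*} [Field k] [Field K] [Algebra k K] (ψ : K) : Prop :=
  ψ ∉ (⊥ : IntermediateField k K) ∧ IsAlgClosedInside (IntermediateField.adjoin k {ψ})

/-- `ψ` is generative for `φ` if `ψ` is closed and `φ = H(ψ)` for some `H ∈ k(t)`, that is,
`φ ∈ k(ψ)`. -/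
def IsGenerative (k : Type*) {K : Type*} [Field k] [Field K] [Algebra k K] (ψ φ : K) : Prop :=
  IsClosedElement k ψ ∧ φ ∈ IntermediateField.adjoin k {ψ}

/-- A subfield `k ⊆ L ⊆ K` is saturated in `K` if it contains a generative element of each of its
elements not in `k`. -/
def IsSaturated {k K : Type*} [Field k] [Field K] [Algebra k K]
    (L : IntermediateField k K) : Prop :=
  ∀ φ ∈ L, φ ∉ (⊥ : IntermediateField k K) → ∃ ψ ∈ L, IsGenerative k ψ φ

/-- `H` is isomorphic to the binary icosahedral group `I_120`: the preimage in `SL_2(ℂ)` of a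
subgroup of `PSL_2(ℂ)` isomorphic to the alternating group `A_5`. -/
def IsBinaryIcosahedral (H : Type*) [Group H] : Prop :=
  ∃ A : Subgroup PSL(2, ℂ), Nonempty (A ≃* alternatingGroup (Fin 5)) ∧
    Nonempty (H ≃* A.comap (QuotientGroup.mk' (Subgroup.center SL(2, ℂ))))

end

/-!
The heart of the matter is the action of `G` on those subfields `k(ψ)` of `K = k(x₁, …, xₙ)` which
it preserves: the field of invariants is saturated exactly when all these actions are trivial, and a
nontrivial one exists exactly when `G` has a nontrivial abelian or a binary icosahedral factor
group.

Suppose `G` has no nontrivial abelian and no binary icosahedral factor groups, so that `G` is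
perfect, and let `φ` be a nonconstant invariant. By the theorem of Lüroth and Gordan
(`exists_eq_adjoin_simple_of_isAlgebraic`) the algebraic closure of `k(φ)` in `K` is `k(ψ)` for some
`ψ`, and it is preserved by `G`. Writing `ψ = P / Q` in lowest terms, the Möbius transformations by
which `G` acts on `ψ` lift to a linear representation of `G` on the span of the polynomials `P` and
`Q` (`exists_linear_of_preserves`), with image in `SL₂(k)` because `G` is perfect. A nontrivial
finite perfect subgroup of `SL₂` is binary icosahedral (`isBinaryIcosahedral_of_injective`), so the
image is trivial and `ψ` is invariant (`mem_invariantSubfield_of_stable`).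

The classification of finite perfect subgroups `H` of `SL₂` counts orbits on the projective line:
each nontrivial element of the image of `H` in `PSL₂` has exactly two fixed points, and since
perfect groups have no proper subgroups of index at most `4`, only the order `60` survives
(`card_eq_sixty_of_isPerfect`). A perfect group of order `60` acts on the five cosets of the
normalizer of a Sylow `2`-subgroup and is therefore `A₅`
(`nonempty_mulEquiv_alternatingGroup_of_isPerfect`). As the binary icosahedral group is defined
over `ℂ`, finite groups of matrices are moved between `k` and `ℂ` by specialization
(`exists_injective_hom_specialLinearGroup`).

Conversely, suppose that the field of invariants is saturated. Then `G` fixes every `ψ` for which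
`k(ψ)` is preserved by `G` (`mem_invariantSubfield_of_isSaturated`). Sums of the form
`∑ c(g) g(f)` realize characters and two-dimensional representations of `G` inside `K`. A
nontrivial character gives a semi-invariant `ψ`, which is not fixed; this excludes abelian factor
groups, so `G` is perfect. A binary icosahedral factor group gives a representation with value `-1`
somewhere, spanned by some `ψ₀` and `ψ₁`; here `k(ψ₁ / ψ₀)` is preserved, and `ψ₁ / ψ₀` cannot be
fixed (`ne_neg_one_of_isSaturated`).
-/

/-! ### Finite perfect groups of small index or order -/

theorem isSolvable_perm_fin_four : Group.IsSolvable (Equiv.Perm (Fin 4)) := by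
  have hA : Group.IsSolvable (alternatingGroup (Fin 4)) := by
    have h4 : Nat.card (Fin 4) = 4 := by simp
    have hV := (alternatingGroup.kleinFour_isKleinFour (α := Fin 4) h4)
    have hc : IsMulCommutative (alternatingGroup.kleinFour (Fin 4)) :=
      IsPGroup.isMulCommutative_of_card_eq_prime_sq (p := 2) hV.card_four
    refine ⟨2, ?_⟩
    rw [derivedSeries_succ, derivedSeries_one,
      ← alternatingGroup.kleinFour_eq_commutator h4, Subgroup.commutator_eq_bot_iff_le_centralizer]
    exact Subgroup.le_centralizer_iff_isMulCommutative.mpr hc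
  refine Group.isSolvable_of_ker_le_range (alternatingGroup (Fin 4)).subtype Equiv.Perm.sign ?_
  rw [Subgroup.range_subtype, alternatingGroup_eq_sign_ker]

theorem isSolvable_perm_of_card_le_four {α : Type*} [Finite α] (h : Nat.card α ≤ 4) :
    Group.IsSolvable (Equiv.Perm α) := by
  have := Fintype.ofFinite α
  have := isSolvable_perm_fin_four
  obtain ⟨e⟩ : Nonempty (α ↪ Fin 4) :=
    Function.Embedding.nonempty_of_card_le (by simpa [Nat.card_eq_fintype_card] using h)
  exact Group.isSolvable_of_isSolvable_injective (Equiv.Perm.viaEmbeddingHom_injective e)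

theorem eq_one_of_isPerfect_of_isSolvable {A B : Type*} [Group A] [Group B] [Group.IsPerfect A]
    [Group.IsSolvable B] (f : A →* B) (a : A) : f a = 1 := by
  have := Group.IsPerfect.range f
  have hs : Subsingleton f.range := by
    by_contra h
    have : Nontrivial f.range := not_subsingleton_iff_nontrivial.mp h
    exact Group.IsPerfect.not_isSolvable f.range inferInstance
  exact congrArg Subtype.val (Subsingleton.elim (⟨f a, a, rfl⟩ : f.range) 1)

/-- A perfect group has no proper subgroup of index at most `4`, because the symmetric group on
the cosets would be solvable. -/
theorem eq_top_of_isPerfect_of_index_le_four {A : Type*} [Group A] [Group.IsPerfect A]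
    (H : Subgroup A) [H.FiniteIndex] (h : H.index ≤ 4) : H = ⊤ := by
  have := isSolvable_perm_of_card_le_four (α := A ⧸ H) h
  have hk := eq_one_of_isPerfect_of_isSolvable (MulAction.toPermHom A (A ⧸ H))
  refine eq_top_iff.mpr fun a _ => ?_
  have h1 := DFunLike.congr_fun (hk a) ((1 : A) : A ⧸ H)
  have h2 : ((a * 1 : A) : A ⧸ H) = ((1 : A) : A ⧸ H) := h1
  have h3 := QuotientGroup.eq.mp h2.symm
  simpa using h3

theorem subsingleton_of_isPerfect_of_card_prime {A : Type*} [Group A] [Group.IsPerfect A] {p : ℕ}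
    (hp : p.Prime) (h : Nat.card A = p) : Subsingleton A := by
  have : Fact p.Prime := ⟨hp⟩
  have := isCyclic_of_prime_card h
  infer_instance

/-- A perfect group whose order is divisible by `5` has order at least `25`. -/
theorem five_le_of_isPerfect_of_card_eq_five_mul {A : Type*} [Group A] [Finite A]
    [Group.IsPerfect A] {m : ℕ} (h : Nat.card A = 5 * m) : 5 ≤ m := by
  by_contra! hm
  have hpos : 0 < Nat.card A := Nat.card_pos
  have : Fact (Nat.Prime 5) := ⟨by norm_num⟩
  obtain ⟨P, hP⟩ := Sylow.exists_subgroup_card_pow_prime (G := A) 5 (n := 1) ⟨m, by omega⟩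
  have hi := P.card_mul_index
  have hi' : P.index ≤ 4 := by
    rw [hP, h] at hi
    omega
  have ht := eq_top_of_isPerfect_of_index_le_four _ hi'
  have hc : Nat.card A = 5 := by
    rw [← Subgroup.card_top (G := A), ← ht, hP, pow_one]
  have := subsingleton_of_isPerfect_of_card_prime (by norm_num) hc
  have := Nat.card_of_subsingleton (1 : A)
  omega

open scoped IsMulCommutative in
/-- A perfect group of order `60` has a subgroup of index `5`: the normalizer of a Sylow
`2`-subgroup. -/
theorem exists_index_eq_five_of_isPerfect {A : Type*} [Group A] [Finite A] [Group.IsPerfect A]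
    (h : Nat.card A = 60) : ∃ K : Subgroup A, K.index = 5 := by
  have : Fact (Nat.Prime 2) := ⟨Nat.prime_two⟩
  let P : Sylow 2 A := default
  have hfac : Nat.factorization 60 2 = 2 := by
    rw [Nat.factorization_def _ Nat.prime_two, show 60 = 2 ^ 2 * 15 by norm_num,
      padicValNat.mul (by norm_num) (by norm_num), padicValNat.prime_pow,
      padicValNat.eq_zero_of_not_dvd (by norm_num)]
  have hP : Nat.card (P : Subgroup A) = 2 ^ 2 := by
    rw [P.card_eq_multiplicity, h, hfac]
  have hPi : (P : Subgroup A).index = 15 := by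
    have := (P : Subgroup A).card_mul_index
    rw [hP, h] at this
    omega
  set K := Subgroup.normalizer (P : Set A) with hK
  have hd : K.index ∣ 15 := hPi ▸ Subgroup.index_dvd_of_le Subgroup.le_normalizer
  have hK15 : K.index ≠ 15 := by
    intro h15
    -- otherwise the abelian group `P` is its own normalizer, and Burnside's transfer theorem
    -- gives a normal complement
    have hKP : K = P := by
      refine le_antisymm (Subgroup.relIndex_eq_one.mp ?_) Subgroup.le_normalizer
      have := Subgroup.relIndex_mul_index (Subgroup.le_normalizer : (P : Subgroup A) ≤ K)
      change _ * K.index = _ at this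
      rw [h15, hPi] at this
      change Subgroup.relIndex _ K * 15 = 15 at this
      omega
    have hcomm : IsMulCommutative P := IsPGroup.isMulCommutative_of_card_eq_prime_sq hP
    have hle : Subgroup.normalizer (P : Set A) ≤ Subgroup.centralizer (P : Set A) := by
      rw [← hK, hKP]
      exact Subgroup.le_centralizer_iff_isMulCommutative.mpr hcomm
    have htriv := eq_one_of_isPerfect_of_isSolvable (MonoidHom.transferSylow P hle)
    have hker : (MonoidHom.transferSylow P hle).ker = ⊤ :=
      eq_top_iff.mpr fun a _ => htriv a
    have := MonoidHom.not_dvd_card_ker_transferSylow P hle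
    rw [hker, Subgroup.card_top, h] at this
    omega
  have hK1 : ¬ K.index ≤ 4 := by
    intro h4
    have ht := eq_top_of_isPerfect_of_index_le_four K h4
    have hn : (P : Subgroup A).Normal := Subgroup.normalizer_eq_top_iff.mp ht
    have hcard : Nat.card (A ⧸ (P : Subgroup A)) = 5 * 3 := hPi
    have := five_le_of_isPerfect_of_card_eq_five_mul hcard
    omega
  refine ⟨K, ?_⟩
  have : K.index ∈ Nat.divisors 15 := by simpa using hd
  have h15 : Nat.divisors 15 = {1, 3, 5, 15} := by decide
  rw [h15] at this
  simp only [Finset.mem_insert, Finset.mem_singleton] at this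
  omega

/-- A perfect group of order `60` is isomorphic to `A₅`. -/
theorem nonempty_mulEquiv_alternatingGroup_of_isPerfect {A : Type*} [Group A] [Finite A]
    [Group.IsPerfect A] (h : Nat.card A = 60) : Nonempty (A ≃* alternatingGroup (Fin 5)) := by
  obtain ⟨K, hK⟩ := exists_index_eq_five_of_isPerfect h
  have hfin : Finite (A ⧸ K) := inferInstance
  obtain ⟨e⟩ : Nonempty ((A ⧸ K) ≃ Fin 5) := ⟨Finite.equivFinOfCardEq hK⟩
  let f : A →* Equiv.Perm (Fin 5) :=
    (e.permCongrHom : Equiv.Perm (A ⧸ K) →* Equiv.Perm (Fin 5)).comp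
      (MulAction.toPermHom A (A ⧸ K))
  have hker : f.ker ≤ K := by
    intro a ha
    have h0 : MulAction.toPermHom A (A ⧸ K) a = 1 := e.permCongrHom.injective (by
      rw [map_one]; exact ha)
    have h2 : ((a * 1 : A) : A ⧸ K) = ((1 : A) : A ⧸ K) := DFunLike.congr_fun h0 ((1 : A) : A ⧸ K)
    simpa using QuotientGroup.eq.mp h2.symm
  let g : A →* alternatingGroup (Fin 5) := f.codRestrict _ fun a => by
    rw [Equiv.Perm.mem_alternatingGroup]
    exact eq_one_of_isPerfect_of_isSolvable (Equiv.Perm.sign.comp f) a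
  have hgker : g.ker = f.ker := by
    ext a
    simp [MonoidHom.mem_ker, g]
  have hA5 : Nat.card (alternatingGroup (Fin 5)) = 60 := by
    rw [nat_card_alternatingGroup]; simp [Nat.factorial]
  have hA5p : Group.IsPerfect (alternatingGroup (Fin 5)) :=
    ⟨commutator_alternatingGroup_eq_top (by simp)⟩
  have hR : Group.IsPerfect g.range := Group.IsPerfect.range g
  -- the order of the image is a multiple of `5`, the index of `K`
  have h5 : 5 ∣ Nat.card g.range := by
    rw [← Subgroup.index_ker, hgker]
    exact hK.symm.dvd.trans (Subgroup.index_dvd_of_le hker)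
  obtain ⟨m, hm⟩ := h5
  have hm5 := five_le_of_isPerfect_of_card_eq_five_mul hm
  have hidx := g.range.card_mul_index
  rw [hm, hA5] at hidx
  have hi4 : g.range.index ≤ 4 := by
    have : m * g.range.index = 12 := by nlinarith
    nlinarith
  have htop := eq_top_of_isPerfect_of_index_le_four g.range hi4
  have hsurj : Function.Surjective g := MonoidHom.range_eq_top.mp htop
  exact ⟨MulEquiv.ofBijective g
    ((Nat.bijective_iff_surjective_and_card g).mpr ⟨hsurj, h.trans hA5.symm⟩)⟩

/-- The numerical part of the classification: orbits of lengths `mᵢ = N / nᵢ` with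
`m₁ + m₂ + m₃ = N + 2` are those of the dihedral, tetrahedral, octahedral and icosahedral groups,
and the first two have an orbit with fewer than `5` points. -/
theorem eq_of_orbit_lengths {N m₁ m₂ m₃ n₁ n₂ n₃ : ℕ} (h : m₁ + m₂ + m₃ = N + 2)
    (h₁ : m₁ * n₁ = N) (h₂ : m₂ * n₂ = N) (h₃ : m₃ * n₃ = N)
    (hm₂ : 5 ≤ m₂) (hm₃ : 5 ≤ m₃) (hn₁ : 2 ≤ n₁) (h₁₂ : n₁ ≤ n₂) (h₂₃ : n₂ ≤ n₃) :
    N = 24 ∨ N = 60 := by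
  have e₁ : n₁ = 2 := by
    by_contra hne
    have : 3 ≤ n₁ := by omega
    nlinarith [Nat.mul_le_mul_left m₁ this, Nat.mul_le_mul_left m₂ (this.trans h₁₂),
      Nat.mul_le_mul_left m₃ (this.trans (h₁₂.trans h₂₃))]
  subst e₁
  have e₂ : n₂ = 3 := by
    by_contra hne
    rcases h₁₂.eq_or_lt with e | hlt
    · subst e
      omega
    · have : 4 ≤ n₂ := by omega
      nlinarith [Nat.mul_le_mul_left m₂ this, Nat.mul_le_mul_left m₃ (this.trans h₂₃)]
  subst e₂
  have h6 : n₃ < 6 := by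
    by_contra! h6
    have := Nat.mul_le_mul_left m₃ h6
    omega
  interval_cases n₃ <;> omega

/-- Let a nontrivial finite perfect group act without global fixed points, each nontrivial element
having exactly two fixed points. Then its order is `60`: this is the classical count of orbits on
the sphere, in which perfectness leaves only the icosahedral case. -/
theorem card_eq_sixty_of_isPerfect {A X : Type*} [Group A] [Finite A] [Group.IsPerfect A]
    [Nontrivial A] [MulAction A X] (h2 : ∀ a : A, a ≠ 1 → (MulAction.fixedBy X a).ncard = 2)
    (hfix : ∀ x : X, MulAction.stabilizer A x ≠ ⊤) : Nat.card A = 60 := by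
  classical
  have := Fintype.ofFinite A
  -- the points with nontrivial stabilizer
  let Y : SubMulAction A X :=
    { carrier := {x | ∃ a : A, a ≠ 1 ∧ a • x = x}
      smul_mem' := by
        rintro c x ⟨a, ha, hax⟩
        refine ⟨c * a * c⁻¹, fun h => ha ?_, ?_⟩
        · simpa using h
        · simp [mul_smul, hax] }
  have hYfin : Finite Y := by
    have : (Y : Set X) = ⋃ a : {a : A // a ≠ 1}, MulAction.fixedBy X a.1 := by
      ext x
      simp only [Set.mem_iUnion, MulAction.mem_fixedBy, Subtype.exists, exists_prop]
      rfl
    refine Set.Finite.to_subtype (s := (Y : Set X)) ?_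
    rw [this]
    exact Set.finite_iUnion fun a => Set.finite_of_ncard_ne_zero (by rw [h2 _ a.2]; norm_num)
  have := Fintype.ofFinite Y
  have := Fintype.ofFinite (MulAction.orbitRel.Quotient A Y)
  have hB := MulAction.sum_card_fixedBy_eq_card_orbits_mul_card_group A Y
  have hg1 : ∀ a : A, a ≠ 1 → Fintype.card (MulAction.fixedBy Y a) = 2 := by
    intro a ha
    rw [← h2 a ha, ← Nat.card_coe_set_eq, ← Nat.card_eq_fintype_card]
    exact Nat.card_congr
      { toFun := fun y => ⟨y.1.1, congrArg Subtype.val y.2⟩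
        invFun := fun x => ⟨⟨x.1, a, ha, x.2⟩, Subtype.ext x.2⟩
        left_inv := fun _ => rfl
        right_inv := fun _ => rfl }
  have hg0 : Fintype.card (MulAction.fixedBy Y (1 : A)) = Fintype.card Y := by
    rw [← Nat.card_eq_fintype_card, ← Nat.card_eq_fintype_card]
    exact Nat.card_congr (Equiv.subtypeUnivEquiv fun y => one_smul A y)
  rw [← Finset.add_sum_erase _ _ (Finset.mem_univ (1 : A)), hg0,
    Finset.sum_congr rfl (fun a ha => hg1 a (Finset.ne_of_mem_erase ha)), Finset.sum_const,
    Finset.card_erase_of_mem (Finset.mem_univ _), Finset.card_univ, smul_eq_mul] at hB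
  set N := Fintype.card A with hN
  have hN2 : 2 ≤ N := Fintype.one_lt_card
  let m : MulAction.orbitRel.Quotient A Y → ℕ := fun ω => (MulAction.stabilizer A ω.out).index
  let n : MulAction.orbitRel.Quotient A Y → ℕ := fun ω =>
    Nat.card (MulAction.stabilizer A ω.out)
  have hmn : ∀ ω, m ω * n ω = N := fun ω => by
    rw [hN, ← Nat.card_eq_fintype_card, ← (MulAction.stabilizer A ω.out).card_mul_index, mul_comm]
  have hstab : ∀ y : Y, MulAction.stabilizer A y = MulAction.stabilizer A (y : X) := fun y => by
    ext a
    exact Subtype.ext_iff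
  have hm5 : ∀ ω, 5 ≤ m ω := fun ω => by
    by_contra! hlt
    refine hfix (ω.out : X) ?_
    rw [← hstab]
    exact eq_top_of_isPerfect_of_index_le_four _ (Nat.le_of_lt_succ hlt)
  have hn2 : ∀ ω, 2 ≤ n ω := fun ω => by
    obtain ⟨a, ha, hax⟩ := ω.out.2
    have : Nontrivial (MulAction.stabilizer A ω.out) :=
      ⟨⟨⟨a, Subtype.ext hax⟩, 1, fun h => ha (congrArg Subtype.val h)⟩⟩
    exact Finite.one_lt_card
  have hYm : Fintype.card Y = ∑ ω, m ω := by
    rw [← Nat.card_eq_fintype_card,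
      Nat.card_congr (MulAction.selfEquivSigmaOrbitsQuotientStabilizer A Y), Nat.card_sigma]
    rfl
  set r := Fintype.card (MulAction.orbitRel.Quotient A Y) with hr
  have hlow : 5 * r ≤ Fintype.card Y := by
    rw [hYm, hr, mul_comm, ← smul_eq_mul, ← Finset.card_univ, ← Finset.sum_const]
    exact Finset.sum_le_sum fun ω _ => hm5 ω
  have hupp : 2 * Fintype.card Y ≤ r * N := by
    rw [hYm, hr, ← smul_eq_mul (a := Fintype.card _), ← Finset.card_univ, ← Finset.sum_const,
      Finset.mul_sum]
    exact Finset.sum_le_sum fun ω _ => by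
      rw [← hmn ω, mul_comm]; exact Nat.mul_le_mul_left _ (hn2 ω)
  have hr3 : r = 3 := by
    have h4 : r < 4 := by
      by_contra! h4
      have := Nat.mul_le_mul_right N h4
      omega
    interval_cases r <;> omega
  have e : MulAction.orbitRel.Quotient A Y ≃ Fin 3 := Fintype.equivFinOfCardEq hr3
  rw [← e.symm.sum_comp, Fin.sum_univ_three] at hYm
  have hsum : m (e.symm 0) + m (e.symm 1) + m (e.symm 2) = N + 2 := by
    rw [hr3] at hB
    omega
  have hcases : N = 24 ∨ N = 60 := by
    generalize e.symm 0 = a at *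
    generalize e.symm 1 = b at *
    generalize e.symm 2 = c at *
    rcases le_total (n a) (n b) with hab | hab <;> rcases le_total (n b) (n c) with hbc | hbc <;>
      rcases le_total (n a) (n c) with hac | hac
    · exact eq_of_orbit_lengths hsum (hmn a) (hmn b) (hmn c) (hm5 b) (hm5 c) (hn2 a) hab hbc
    · exact eq_of_orbit_lengths hsum (hmn a) (hmn b) (hmn c) (hm5 b) (hm5 c) (hn2 a) hab hbc
    · exact eq_of_orbit_lengths (by omega) (hmn a) (hmn c) (hmn b) (hm5 c) (hm5 b)
        (hn2 a) hac hbc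
    · exact eq_of_orbit_lengths (by omega) (hmn c) (hmn a) (hmn b) (hm5 a) (hm5 b)
        (hn2 c) hac hab
    · exact eq_of_orbit_lengths (by omega) (hmn b) (hmn a) (hmn c) (hm5 a) (hm5 c)
        (hn2 b) hab hac
    · exact eq_of_orbit_lengths (by omega) (hmn b) (hmn c) (hmn a) (hm5 c) (hm5 a)
        (hn2 b) hbc hac
    · exact eq_of_orbit_lengths (by omega) (hmn c) (hmn b) (hmn a) (hm5 b) (hm5 a)
        (hn2 c) hbc hab
    · exact eq_of_orbit_lengths (by omega) (hmn c) (hmn b) (hmn a) (hm5 b) (hm5 a)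
        (hn2 c) hbc hab
  rw [Nat.card_eq_fintype_card]
  refine hcases.resolve_left fun h24 => ?_
  -- in order `24` the Sylow `2`-subgroups have index `3`
  obtain ⟨P, hP⟩ := Sylow.exists_subgroup_card_pow_prime (G := A) 2 (n := 3)
    ⟨3, by rw [Nat.card_eq_fintype_card, ← hN, h24]; norm_num⟩
  have hi := P.card_mul_index
  rw [hP, Nat.card_eq_fintype_card, ← hN, h24] at hi
  have htop := eq_top_of_isPerfect_of_index_le_four P (by omega)
  rw [htop, Subgroup.index_top] at hi
  omega

/-! ### Finite perfect subgroups of `SL₂` -/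

open Matrix in
/-- A matrix of finite order in `SL₂` over an algebraically closed field of characteristic zero
that is not scalar has two distinct eigenvalues. -/
theorem exists_eigenvectors_of_pow_eq_one {K : Type*} [Field K] [IsAlgClosed K] [CharZero K]
    (g : SL(2, K)) {m : ℕ} (hm : m ≠ 0) (hgm : g ^ m = 1) (hg : g ∉ Subgroup.center SL(2, K)) :
    ∃ (a b : K) (v w : Fin 2 → K), a ≠ b ∧ a * b = 1 ∧ v ≠ 0 ∧ w ≠ 0 ∧
      g.1 *ᵥ v = a • v ∧ g.1 *ᵥ w = b • w ∧
      ∀ (u : Fin 2 → K) (c : K), u ≠ 0 → g.1 *ᵥ u = c • u → c = a ∨ c = b := by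
  have hdet : g.1 0 0 * g.1 1 1 - g.1 0 1 * g.1 1 0 = 1 := by
    rw [← Matrix.det_fin_two]; exact g.2
  obtain ⟨s, hs⟩ := IsAlgClosed.exists_pow_nat_eq ((g.1 0 0 + g.1 1 1) ^ 2 - 4) (n := 2) (by norm_num)
  obtain ⟨a, ha⟩ : ∃ a, a = (g.1 0 0 + g.1 1 1 + s) / 2 := ⟨_, rfl⟩
  obtain ⟨b, hb⟩ : ∃ b, b = (g.1 0 0 + g.1 1 1 - s) / 2 := ⟨_, rfl⟩
  have hsum : a + b = g.1 0 0 + g.1 1 1 := by rw [ha, hb]; ring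
  have hprod : a * b = 1 := by rw [ha, hb]; linear_combination (-1 / 4) * hs
  have hroot : ∀ c, (g.1 - scalar (Fin 2) c).det = (c - a) * (c - b) := fun c => by
    rw [det_fin_two]
    simp
    linear_combination hdet + c * hsum - hprod
  have hCH : (g.1 - scalar (Fin 2) a) * (g.1 - scalar (Fin 2) b) = 0 := by
    ext i j
    fin_cases i <;> fin_cases j <;> simp [Matrix.mul_apply, Fin.sum_univ_two]
    · linear_combination hprod - hdet - g.1 0 0 * hsum
    · linear_combination - g.1 0 1 * hsum
    · linear_combination - g.1 1 0 * hsum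
    · linear_combination hprod - hdet - g.1 1 1 * hsum
  have hcomm : ∀ c, Commute (scalar (Fin 2) c) (g.1 - scalar (Fin 2) a) := fun c =>
    Matrix.scalar_commute c (fun _ => Commute.all _ _) _
  have hsub : ∀ c (u : Fin 2 → K), (g.1 - scalar (Fin 2) c) *ᵥ u = g.1 *ᵥ u - c • u := by
    intro c u
    rw [sub_mulVec]
    congr 1
    ext i
    fin_cases i <;> simp [Matrix.mulVec, dotProduct]
  have hgm' : g.1 ^ m = 1 := by
    have := congrArg Subtype.val hgm
    simpa using this
  have hab : a ≠ b := by
    intro hab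
    rw [← hab] at hCH hprod
    -- then `g = a + M` with `M ^ 2 = 0`, and `g ^ m = 1` forces `M = 0`
    set M := g.1 - scalar (Fin 2) a with hM
    have hpow : ∀ j : ℕ, g.1 ^ (j + 1) = scalar (Fin 2) (a ^ (j + 1)) +
        scalar (Fin 2) ((j + 1) * a ^ j) * M := by
      intro j
      induction j with
      | zero => simp [hM]
      | succ j ih =>
        have hg' : g.1 = scalar (Fin 2) a + M := by rw [hM]; abel
        rw [pow_succ, ih]
        conv_lhs => rw [hg']
        rw [add_mul, mul_add, mul_add, mul_assoc _ M M, hCH, mul_zero, add_zero,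
          mul_assoc _ M (scalar (Fin 2) a), ← (hcomm a).eq, ← mul_assoc, ← map_mul, ← map_mul,
          add_assoc, ← add_mul, ← map_add]
        have e : a ^ (j + 1) + ((j : K) + 1) * a ^ j * a = ((j + 1 : ℕ) + 1) * a ^ (j + 1) := by
          push_cast
          ring
        rw [e, ← pow_succ]
    obtain ⟨j, rfl⟩ := Nat.exists_eq_succ_of_ne_zero hm
    have hp := hpow j
    rw [Nat.succ_eq_add_one] at hgm'
    rw [hgm'] at hp
    have h1 : M = scalar (Fin 2) (a ^ (j + 1)) * M := by
      have := congrArg (· * M) hp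
      simpa [add_mul, mul_assoc, hCH] using this
    have hM0 : M = 0 := by
      by_contra hne
      have ha1 : a ^ (j + 1) = 1 := by
        by_contra h
        apply hne
        have h2 : scalar (Fin 2) (a ^ (j + 1) - 1) * M = 0 := by
          rw [map_sub, sub_mul, ← h1]; simp
        have h3 := congrArg (fun N => scalar (Fin 2) (a ^ (j + 1) - 1)⁻¹ * N) h2
        simpa only [← mul_assoc, ← map_mul, inv_mul_cancel₀ (sub_ne_zero.mpr h), map_one, one_mul,
          mul_zero] using h3
      rw [ha1, map_one, left_eq_add] at hp
      have ha0 : a ≠ 0 := left_ne_zero_of_mul_eq_one hprod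
      have hc : ((j : K) + 1) * a ^ j ≠ 0 := mul_ne_zero (by exact_mod_cast j.succ_ne_zero)
        (pow_ne_zero _ ha0)
      have h3 := congrArg (fun N => scalar (Fin 2) (((j : K) + 1) * a ^ j)⁻¹ * N) hp
      apply hne
      simpa only [← mul_assoc, ← map_mul, inv_mul_cancel₀ hc, map_one, one_mul, mul_zero] using h3
    refine hg (Matrix.SpecialLinearGroup.mem_center_iff.mpr ⟨a, ?_, (sub_eq_zero.mp hM0).symm⟩)
    rw [Fintype.card_fin, sq, hprod]
  obtain ⟨v, hv, hv'⟩ := Matrix.exists_mulVec_eq_zero_iff.mpr (by rw [hroot a]; simp :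
    (g.1 - scalar (Fin 2) a).det = 0)
  obtain ⟨w, hw, hw'⟩ := Matrix.exists_mulVec_eq_zero_iff.mpr (by rw [hroot b]; simp :
    (g.1 - scalar (Fin 2) b).det = 0)
  rw [hsub, sub_eq_zero] at hv' hw'
  refine ⟨a, b, v, w, hab, hprod, hv, hw, hv', hw', fun u c hu huc => ?_⟩
  have := Matrix.exists_mulVec_eq_zero_iff.mp ⟨u, hu, (by rw [hsub, huc, sub_self] :
    (g.1 - scalar (Fin 2) c) *ᵥ u = 0)⟩
  rw [hroot, mul_eq_zero, sub_eq_zero, sub_eq_zero] at this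
  exact this

open Matrix in
/-- If two points of the projective line are eigenlines for the same eigenvalue of a matrix which
is not scalar, they agree. -/
theorem projectivization_mk_eq_of_mulVec {K : Type*} [Field K] {g : SL(2, K)}
    (hg : g ∉ Subgroup.center SL(2, K)) {a : K} {u v : Fin 2 → K} (hu : u ≠ 0) (hv : v ≠ 0)
    (hua : g.1 *ᵥ u = a • u) (hva : g.1 *ᵥ v = a • v) :
    Projectivization.mk K u hu = Projectivization.mk K v hv := by
  have hd : u 0 * v 1 = u 1 * v 0 := by
    by_contra hne
    apply hg
    have hd' : u 0 * v 1 - u 1 * v 0 ≠ 0 := sub_ne_zero.mpr hne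
    have e1 := congrFun hua 0
    have e2 := congrFun hua 1
    have e3 := congrFun hva 0
    have e4 := congrFun hva 1
    simp [Matrix.mulVec, dotProduct, Fin.sum_univ_two] at e1 e2 e3 e4
    have hsc : scalar (Fin 2) a = g.1 := by
      ext i j
      fin_cases i <;> fin_cases j <;> simp <;> apply mul_right_cancel₀ hd'
      · linear_combination u 1 * e3 - v 1 * e1
      · linear_combination v 0 * e1 - u 0 * e3
      · linear_combination u 1 * e4 - v 1 * e2
      · linear_combination v 0 * e2 - u 0 * e4
    refine Matrix.SpecialLinearGroup.mem_center_iff.mpr ⟨a, ?_, hsc⟩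
    have := g.2
    rw [← hsc] at this
    simpa using this
  rw [Projectivization.mk_eq_mk_iff']
  by_cases hv0 : v 0 = 0
  · have hv1 : v 1 ≠ 0 := fun h => hv (by ext i; fin_cases i <;> simp [hv0, h])
    refine ⟨u 1 / v 1, ?_⟩
    have hu0 : u 0 = 0 := by
      rw [hv0, mul_zero] at hd
      exact (mul_eq_zero.mp hd).resolve_right hv1
    ext i
    fin_cases i <;> simp [hv0, hu0, hv1]
  · refine ⟨u 0 / v 0, ?_⟩
    ext i
    fin_cases i
    · simp [hv0]
    · simp; field_simp; linear_combination hd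

open Matrix in
theorem smul_projectivization_mk_eq_iff {K : Type*} [Field K] (g : SL(2, K)) {u : Fin 2 → K}
    (hu : u ≠ 0) : g • Projectivization.mk K u hu = Projectivization.mk K u hu ↔
      ∃ c : K, g.1 *ᵥ u = c • u := by
  rw [Projectivization.smul_mk, Projectivization.mk_eq_mk_iff']
  exact exists_congr fun c => eq_comm

open Matrix in
/-- A nonscalar matrix of finite order in `SL₂` fixes exactly two points of the projective line. -/
theorem ncard_fixedBy_projectivization {K : Type*} [Field K] [IsAlgClosed K] [CharZero K]
    (g : SL(2, K)) {m : ℕ} (hm : m ≠ 0) (hgm : g ^ m = 1) (hg : g ∉ Subgroup.center SL(2, K)) :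
    {x : Projectivization K (Fin 2 → K) | g • x = x}.ncard = 2 := by
  obtain ⟨a, b, v, w, hab, -, hv, hw, hva, hwb, huniq⟩ :=
    exists_eigenvectors_of_pow_eq_one g hm hgm hg
  refine Set.ncard_eq_two.mpr ⟨Projectivization.mk K v hv, Projectivization.mk K w hw, ?_, ?_⟩
  · intro h
    rw [Projectivization.mk_eq_mk_iff'] at h
    obtain ⟨c, rfl⟩ := h
    rw [mulVec_smul, hwb, smul_comm] at hva
    exact hab (smul_left_injective K hv hva).symm
  · ext x
    induction x using Projectivization.ind with | _ u hu =>
    simp only [Set.mem_ofPred_eq, Set.mem_insert_iff, Set.mem_singleton_iff]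
    constructor
    · rw [smul_projectivization_mk_eq_iff]
      rintro ⟨c, hc⟩
      rcases huniq u c hu hc with rfl | rfl
      · exact Or.inl (projectivization_mk_eq_of_mulVec hg hu hv hc hva)
      · exact Or.inr (projectivization_mk_eq_of_mulVec hg hu hw hc hwb)
    · rintro (h | h) <;> rw [h, smul_projectivization_mk_eq_iff]
      exacts [⟨a, hva⟩, ⟨b, hwb⟩]

open Matrix in
/-- A perfect subgroup of `SL₂` of finite order which fixes a point of the projective line is
trivial. -/
theorem eq_one_of_isPerfect_of_fixes {K : Type*} [Field K] [IsAlgClosed K] [CharZero K]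
    (H : Subgroup SL(2, K)) [Finite H] [Group.IsPerfect H] {u : Fin 2 → K} (hu : u ≠ 0)
    (hfix : ∀ h ∈ H, ∃ c : K, h.1 *ᵥ u = c • u) {h : SL(2, K)} (hh : h ∈ H) : h = 1 := by
  choose c hc using hfix
  have hinj := smul_left_injective K hu
  -- the eigenvalue of `h` on the fixed line is a character, trivial because `H` is perfect
  let χ : H →* K :=
    { toFun := fun h => c h.1 h.2
      map_one' := hinj (by
        change c 1 _ • u = (1 : K) • u
        rw [← hc]; simp)
      map_mul' := fun x y => hinj (by
        change c (x.1 * y.1) _ • u = (_ * _) • u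
        rw [← hc, Matrix.SpecialLinearGroup.coe_mul, ← mulVec_mulVec, hc _ y.2, mulVec_smul,
          hc _ x.2, smul_smul, mul_comm]) }
  have hχ : ∀ x : H, χ x = 1 := fun x => by
    have := eq_one_of_isPerfect_of_isSolvable χ.toHomUnits x
    simpa using congrArg Units.val this
  have hu1 : h.1 *ᵥ u = (1 : K) • u := by
    rw [hc h hh, show c h hh = 1 from hχ ⟨h, hh⟩]
  have hpow : h ^ Nat.card H = 1 := by
    have := pow_card_eq_one' (x := (⟨h, hh⟩ : H))
    exact congrArg Subtype.val this
  by_cases hz : h ∈ Subgroup.center SL(2, K)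
  · obtain ⟨r, -, hr⟩ := Matrix.SpecialLinearGroup.mem_center_iff.mp hz
    have hr1 : r = 1 := hinj (by
      change r • u = (1 : K) • u
      rw [← hu1, ← hr]
      ext i
      fin_cases i <;> simp [Matrix.mulVec, dotProduct])
    apply Subtype.ext
    rw [← hr, hr1]
    simp
  · obtain ⟨a, b, -, -, hab, hab1, -, -, -, -, huniq⟩ :=
      exists_eigenvectors_of_pow_eq_one h Nat.card_pos.ne' hpow hz
    exfalso
    rcases huniq u 1 hu hu1 with rfl | rfl
    · exact hab (by simpa using hab1.symm)
    · exact hab (by simpa using hab1)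

/-- Nontrivial finite perfect subgroups of `SL₂` contain `-1`, and modulo the center they are
isomorphic to `A₅`. -/
theorem center_le_and_mulEquiv_alternatingGroup {K : Type*} [Field K] [IsAlgClosed K] [CharZero K]
    (H : Subgroup SL(2, K)) [Finite H] [Group.IsPerfect H] [Nontrivial H] :
    Subgroup.center SL(2, K) ≤ H ∧
      Nonempty (H.map (QuotientGroup.mk' (Subgroup.center SL(2, K))) ≃*
        alternatingGroup (Fin 5)) := by
  set A : Subgroup PSL(2, K) := H.map (QuotientGroup.mk' (Subgroup.center SL(2, K))) with hA
  have hAp : Group.IsPerfect A := Group.IsPerfect.map _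
  have hAfin : Finite A := by
    have : (A : Set PSL(2, K)).Finite := (Set.toFinite (H : Set SL(2, K))).image _
    exact this.to_subtype
  have hpow : ∀ h ∈ H, h ^ Nat.card H = 1 := fun h hh => by
    have := pow_card_eq_one' (x := (⟨h, hh⟩ : H))
    exact congrArg Subtype.val this
  have hAnt : Nontrivial A := by
    by_contra hnt
    rw [Subgroup.nontrivial_iff_ne_bot, not_not, hA, Subgroup.map_eq_bot_iff,
      QuotientGroup.ker_mk'] at hnt
    have : IsMulCommutative H := ⟨⟨fun a b => Subtype.ext
      (Subgroup.mem_center_iff.mp (hnt b.2) a.1)⟩⟩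
    exact Group.IsPerfect.not_isMulCommutative H this
  have hcard : Nat.card A = 60 := by
    refine card_eq_sixty_of_isPerfect (X := Projectivization K (Fin 2 → K)) ?_ ?_
    · rintro ⟨_, h, hh, rfl⟩ hne
      refine ncard_fixedBy_projectivization h Nat.card_pos.ne' (hpow h hh) fun hz => hne ?_
      exact Subtype.ext ((QuotientGroup.eq_one_iff h).mpr hz)
    · intro x
      induction x using Projectivization.ind with | _ u hu =>
      intro htop
      obtain ⟨h, hne⟩ := exists_ne (1 : H)
      refine hne (Subtype.ext (eq_one_of_isPerfect_of_fixes H hu (fun h hh => ?_) h.2))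
      rw [← smul_projectivization_mk_eq_iff _ hu]
      have : (⟨_, h, hh, rfl⟩ : A) ∈ MulAction.stabilizer A (Projectivization.mk K u hu) := by
        rw [htop]; trivial
      exact this
  refine ⟨?_, nonempty_mulEquiv_alternatingGroup_of_isPerfect hcard⟩
  have h2 : 2 ∣ Nat.card H :=
    (show 2 ∣ Nat.card A by rw [hcard]; norm_num).trans (Subgroup.card_map_dvd _ _)
  -- an element of order `2` in `H` has to be `-1`
  obtain ⟨⟨h, hh⟩, hord⟩ := exists_prime_orderOf_dvd_card' 2 h2
  have hord' : orderOf h = 2 :=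
    (Subgroup.orderOf_coe (⟨h, hh⟩ : H)).trans hord
  have hsq : h ^ 2 = 1 := (congrArg (h ^ ·) hord').symm.trans (pow_orderOf_eq_one h)
  have hz : h ∈ Subgroup.center SL(2, K) := by
    by_contra hz
    obtain ⟨a, b, v, w, hab, hab1, hv, hw, hva, hwb, -⟩ :=
      exists_eigenvectors_of_pow_eq_one h two_ne_zero hsq hz
    have hsq' : h.1 * h.1 = 1 := by
      rw [← sq]; simpa using congrArg Subtype.val hsq
    have ha : a * a = 1 := smul_left_injective K hv (by
      change (a * a) • v = (1 : K) • v
      rw [mul_smul, ← hva, ← Matrix.mulVec_smul, ← hva, Matrix.mulVec_mulVec, hsq']; simp)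
    exact hab (mul_left_cancel₀ (left_ne_zero_of_mul_eq_one hab1) (ha.trans hab1.symm))
  obtain ⟨r, hr2, hr⟩ := Matrix.SpecialLinearGroup.mem_center_iff.mp hz
  have hr1 : r ≠ 1 := by
    rintro rfl
    have : h = 1 := Subtype.ext (by rw [← hr]; simp)
    rw [this, orderOf_one] at hord'
    omega
  have hrm : r = -1 := by
    rw [Fintype.card_fin] at hr2
    exact (sq_eq_one_iff.mp hr2).resolve_left hr1
  intro z hzc
  obtain ⟨s, hs2, hs⟩ := Matrix.SpecialLinearGroup.mem_center_iff.mp hzc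
  rw [Fintype.card_fin] at hs2
  rcases sq_eq_one_iff.mp hs2 with rfl | rfl
  · have : z = 1 := Subtype.ext (by rw [← hs]; simp)
    rw [this]; exact H.one_mem
  · have : z = h := Subtype.ext (by rw [← hs, ← hr, hrm])
    rw [this]; exact hh

/-- As it contains the center, a nontrivial finite perfect subgroup is the full preimage of its
image in `PSL₂`. -/
theorem isBinaryIcosahedral_of_isPerfect (H : Subgroup SL(2, ℂ)) [Finite H] [Group.IsPerfect H]
    [Nontrivial H] : IsBinaryIcosahedral H := by
  obtain ⟨hle, he⟩ := center_le_and_mulEquiv_alternatingGroup H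
  refine ⟨_, he, ⟨MulEquiv.subgroupCongr ?_⟩⟩
  rw [Subgroup.comap_map_eq, QuotientGroup.ker_mk', sup_eq_left.mpr hle]

/-! ### Moving finite linear groups between fields of characteristic zero -/

/-- A weak Nullstellensatz: a nonzero algebra of finite type over a field has a point in every
algebraically closed extension of that field. -/
theorem nonempty_algHom_of_finiteType (k R L : Type*) [Field k] [CommRing R] [Nontrivial R]
    [Algebra k R] [Algebra.FiniteType k R] [Field L] [Algebra k L] [IsAlgClosed L] :
    Nonempty (R →ₐ[k] L) := by
  obtain ⟨M, hM⟩ := Ideal.exists_maximal R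
  let := Ideal.Quotient.field M
  have : Module.Finite k (R ⧸ M) := finite_of_finite_type_of_isJacobsonRing k (R ⧸ M)
  have : Algebra.IsAlgebraic k (R ⧸ M) := Algebra.IsAlgebraic.of_finite k (R ⧸ M)
  exact ⟨(IsAlgClosed.lift : R ⧸ M →ₐ[k] L).comp (Ideal.Quotient.mkₐ k M)⟩

/-- Finitely many elements of a field of characteristic zero lie in a subring with a homomorphism
to any given algebraically closed field of characteristic zero that kills none of the nonzero ones:
take a point of the `ℚ`-algebra generated by them and their inverses. -/
theorem exists_subalgebra_ringHom_ne_zero {F L : Type*} [Field F] [CharZero F] [Field L]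
    [CharZero L] [IsAlgClosed L] {S : Set F} (hS : S.Finite) :
    ∃ (R : Subalgebra ℚ F) (φ : R →+* L), S ⊆ R ∧ ∀ s : R, (s : F) ∈ S → s ≠ 0 → φ s ≠ 0 := by
  set T : Set F := S ∪ S⁻¹ with hT
  have hTfin : T.Finite := hS.union (by rw [← Set.image_inv_eq_inv]; exact hS.image _)
  set R := Algebra.adjoin ℚ T with hR
  have hft : Algebra.FiniteType ℚ R :=
    Subalgebra.fg_iff_finiteType R |>.mp (Subalgebra.fg_def.mpr ⟨T, hTfin, rfl⟩)
  obtain ⟨ι⟩ := nonempty_algHom_of_finiteType ℚ R L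
  refine ⟨R, ι.toRingHom, fun s hs =>
    Algebra.subset_adjoin (Or.inl hs), fun s hs hs0 h0 => ?_⟩
  have hinv : (s : F)⁻¹ ∈ R := Algebra.subset_adjoin (Or.inr (by simpa using hs))
  have hs0' : (s : F) ≠ 0 := fun h => hs0 (Subtype.ext h)
  have hmul : s * ⟨(s : F)⁻¹, hinv⟩ = 1 := Subtype.ext (mul_inv_cancel₀ hs0')
  have h1 := congrArg (ι.toRingHom) hmul
  rw [map_mul, h0, zero_mul, map_one] at h1
  exact zero_ne_one h1

/-- A finite subgroup of `SL₂` over a field of characteristic zero embeds into `SL₂` over any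
algebraically closed field of characteristic zero, and the embedding can be taken to preserve
`-1`. -/
theorem exists_injective_hom_specialLinearGroup {F : Type*} (L : Type*) [Field F] [CharZero F]
    [Field L] [CharZero L] [IsAlgClosed L] {H : Type*} [Group H] [Finite H] (ρ : H →* SL(2, F))
    (hρ : Function.Injective ρ) :
    ∃ σ : H →* SL(2, L), Function.Injective σ ∧ ∀ h, ρ h = -1 → σ h = -1 := by
  let S : Set F := Set.range fun x : H × Fin 2 × Fin 2 =>
    (ρ x.1).1 x.2.1 x.2.2 - (1 : Matrix (Fin 2) (Fin 2) F) x.2.1 x.2.2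
  obtain ⟨R, φ, hSR, hφ⟩ := exists_subalgebra_ringHom_ne_zero (L := L) (Set.finite_range _ : S.Finite)
  have hone : ∀ i j, (1 : Matrix (Fin 2) (Fin 2) F) i j ∈ R := fun i j => by
    rw [Matrix.one_apply]; split_ifs
    exacts [R.one_mem, R.zero_mem]
  have hmem : ∀ h i j, (ρ h).1 i j ∈ R := fun h i j => by
    have := R.add_mem (hSR ⟨(h, i, j), rfl⟩ : (ρ h).1 i j - (1 : Matrix _ _ F) i j ∈ R) (hone i j)
    simpa using this
  let val : R →+* F := R.val
  have hval : Function.Injective val := Subtype.val_injective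
  have hinj : Function.Injective (Matrix.SpecialLinearGroup.map (n := Fin 2) val) := fun A B h => by
    ext i j
    exact congrArg (fun A : SL(2, F) => A.1 i j) h
  have hlift : ∀ h, ∃ A : SL(2, R), Matrix.SpecialLinearGroup.map val A = ρ h := fun h => by
    refine ⟨⟨Matrix.of fun i j => ⟨(ρ h).1 i j, hmem h i j⟩, hval ?_⟩, ?_⟩
    · rw [RingHom.map_det, map_one]
      exact (ρ h).2
    · ext i j
      rfl
  choose τ hτ using hlift
  let τ' : H →* SL(2, R) :=
    { toFun := τ
      map_one' := hinj (by rw [hτ, map_one, map_one])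
      map_mul' := fun x y => hinj (by rw [hτ, map_mul, map_mul, hτ, hτ]) }
  refine ⟨(Matrix.SpecialLinearGroup.map φ).comp τ', ?_, fun h hh => ?_⟩
  · rw [injective_iff_map_eq_one]
    intro h hh
    apply hρ
    rw [map_one]
    ext i j
    by_contra hne
    have hs : ((τ h).1 i j - (1 : Matrix (Fin 2) (Fin 2) R) i j : R).1 =
        (ρ h).1 i j - (1 : Matrix (Fin 2) (Fin 2) F) i j := by
      have h1 : (ρ h).1 i j = val ((τ h).1 i j) := by rw [← hτ]; rfl
      have h2 : (1 : Matrix (Fin 2) (Fin 2) F) i j =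
          val ((1 : Matrix (Fin 2) (Fin 2) R) i j) := by
        rw [Matrix.one_apply, Matrix.one_apply]
        split_ifs <;> simp
      rw [h1, h2, ← map_sub]
      rfl
    refine hφ ((τ h).1 i j - (1 : Matrix (Fin 2) (Fin 2) R) i j) ?_ ?_ ?_
    · rw [hs]; exact ⟨(h, i, j), rfl⟩
    · intro h0
      rw [h0] at hs
      exact hne (sub_eq_zero.mp hs.symm)
    · have h1 : φ ((τ h).1 i j) = (1 : Matrix (Fin 2) (Fin 2) L) i j :=
        congrArg (fun A : SL(2, L) => A.1 i j) hh
      rw [map_sub, h1, sub_eq_zero, Matrix.one_apply, Matrix.one_apply]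
      split_ifs <;> simp
  · have hm : τ h = -1 := hinj (by
      rw [hτ, hh]
      ext i j
      simp [Matrix.one_apply])
    change Matrix.SpecialLinearGroup.map φ (τ h) = -1
    rw [hm]
    ext i j
    simp [Matrix.one_apply]

/-- Every nontrivial finite perfect subgroup of `SL₂` over a field of characteristic zero is a
binary icosahedral group. -/
theorem isBinaryIcosahedral_of_injective {F : Type*} [Field F] [CharZero F] {H : Type*} [Group H]
    [Finite H] [Group.IsPerfect H] [Nontrivial H] (ρ : H →* SL(2, F))
    (hρ : Function.Injective ρ) : IsBinaryIcosahedral H := by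
  obtain ⟨σ, hσ, -⟩ := exists_injective_hom_specialLinearGroup ℂ ρ hρ
  let e : H ≃* σ.range := MonoidHom.ofInjective hσ
  have : Group.IsPerfect σ.range := Group.IsPerfect.range σ
  have : Finite σ.range := Finite.of_equiv _ e.toEquiv
  have : Nontrivial σ.range := e.symm.toEquiv.nontrivial
  obtain ⟨A, hA, ⟨f⟩⟩ := isBinaryIcosahedral_of_isPerfect σ.range
  exact ⟨A, hA, ⟨e.trans f⟩⟩

/-! ### The Lüroth–Gordan theorem -/

open IntermediateField in
/-- Let `K` be the field of fractions of an integrally closed `k`-algebra `A` with a point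
`A → E` at which `φ = P / Q` takes a value transcendental over `k`. Then every subfield of `K`
algebraic over `k(φ)` embeds into `E`: it is integral over the local ring of that point, hence
contained in it. -/
theorem nonempty_algHom_of_transcendental {k A K E : Type*} [Field k] [CommRing A] [IsDomain A]
    [IsIntegrallyClosed A] [Algebra k A] [Field K] [Algebra A K] [IsFractionRing A K]
    [Algebra k K] [IsScalarTower k A K] [Field E] [Algebra k E] (l : A →ₐ[k] E) {P Q : A}
    (hQ : l Q ≠ 0) (htr : Transcendental k (l P / l Q)) (F : IntermediateField k K)
    (hF : ∀ f ∈ F, IsAlgebraic k⟮algebraMap A K P / algebraMap A K Q⟯ f) :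
    Nonempty (F →ₐ[k] E) := by
  set φ : K := algebraMap A K P / algebraMap A K Q with hφ
  let S : Submonoid A := (nonZeroDivisors E).comap l
  have hmemS : ∀ s, s ∈ S ↔ l s ≠ 0 := fun s => mem_nonZeroDivisors_iff_ne_zero
  have hS : S ≤ nonZeroDivisors A := fun s hs => mem_nonZeroDivisors_of_ne_zero (by
    rintro rfl
    exact (hmemS 0).mp hs (map_zero l))
  let O : Subalgebra A K := Localization.subalgebra.ofField K S hS
  have hO : ∀ x : K, x ∈ O ↔ ∃ a s : A, ∃ _ : s ∈ S, x = algebraMap A K a * (algebraMap A K s)⁻¹ :=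
    fun x => Iff.rfl
  have hunit : ∀ s : S, IsUnit (l.toRingHom s) := fun s => isUnit_iff_ne_zero.mpr ((hmemS s).mp s.2)
  let res : O →+* E := IsLocalization.lift (M := S) (g := l.toRingHom) hunit
  have hres : ∀ a : A, res (algebraMap A O a) = l a := fun a => IsLocalization.lift_eq hunit a
  have hS0 : ∀ s ∈ S, algebraMap A K s ≠ 0 := fun s hs =>
    (map_ne_zero_iff _ (IsFractionRing.injective A K)).mpr (nonZeroDivisors.ne_zero (hS hs))
  let Ok : Subalgebra k K := O.restrictScalars k
  let resk : Ok →ₐ[k] E :=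
    { res with
      commutes' := fun c => by
        have h := hres (algebraMap k A c)
        rw [AlgHom.commutes] at h
        rw [← h]
        change res _ = res _
        congr 1
        exact Subtype.ext (IsScalarTower.algebraMap_apply k A K c) }
  have hφO : φ ∈ Ok := (hO φ).mpr ⟨P, Q, (hmemS Q).mpr hQ, div_eq_mul_inv _ _⟩
  have hresφ : resk ⟨φ, hφO⟩ = l P / l Q := by
    rw [eq_div_iff hQ, ← hres Q, ← hres P]
    refine (map_mul res _ _).symm.trans (congrArg res ?_)
    exact Subtype.ext (div_mul_cancel₀ _ (hS0 Q ((hmemS Q).mpr hQ)))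
  have hinv : ∀ x : Ok, resk x ≠ 0 → (x : K)⁻¹ ∈ Ok := fun x hx => by
    obtain ⟨a, s, hs, hxas⟩ := (hO x).mp x.2
    have ha : l a ≠ 0 := by
      intro h0
      have h1 : resk x * l s = l a := by
        rw [← hres s, ← hres a]
        refine (map_mul res _ _).symm.trans (congrArg res ?_)
        refine Subtype.ext ?_
        change (x : K) * algebraMap A K s = _
        rw [hxas, inv_mul_cancel_right₀ (hS0 s hs)]
        rfl
      rw [h0] at h1
      exact (mul_ne_zero hx ((hmemS s).mp hs)) h1
    exact (hO _).mpr ⟨s, a, (hmemS a).mpr ha, by rw [hxas, mul_inv, inv_inv, mul_comm]⟩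
  have hkφ : ∀ x ∈ k⟮φ⟯, x ∈ O := by
    intro x hx
    obtain ⟨r, s, rfl⟩ := (mem_adjoin_simple_iff k x).mp hx
    have hval : ∀ q : Polynomial k, Polynomial.aeval φ q =
        ((Polynomial.aeval (⟨φ, hφO⟩ : Ok) q : Ok) : K) := fun q =>
      (Subalgebra.aeval_coe Ok ⟨φ, hφO⟩ q).symm ▸ rfl
    by_cases hs : s = 0
    · rw [hs, map_zero, div_zero]
      exact O.zero_mem
    · rw [div_eq_mul_inv, hval, hval]
      refine O.mul_mem (Subtype.property (Polynomial.aeval (⟨φ, hφO⟩ : Ok) r)) (hinv _ ?_)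
      rw [← Polynomial.aeval_algHom_apply, hresφ]
      exact fun h => hs ((transcendental_iff.mp htr) s h)
  have hFO : F.toSubalgebra ≤ Ok := by
    intro f hf
    let j : k⟮φ⟯ →+* O :=
      (algebraMap k⟮φ⟯ K).codRestrict O.toSubring fun x => hkφ x x.2
    let := j.toAlgebra
    have : IsScalarTower k⟮φ⟯ O K := IsScalarTower.of_algebraMap_eq fun _ => rfl
    have hint : IsIntegral O f := (hF f hf).isIntegral.tower_top
    obtain ⟨m, hm⟩ := IsIntegral.exists_multiple_integral_of_isLocalization S f hint
    obtain ⟨a, ha⟩ := IsIntegrallyClosed.isIntegral_iff.mp hm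
    refine (hO f).mpr ⟨a, m, m.2, ?_⟩
    rw [ha, Submonoid.smul_def, Algebra.smul_def, mul_comm (algebraMap A K m),
      mul_inv_cancel_right₀ (hS0 m m.2)]
  exact ⟨resk.comp (Subalgebra.inclusion hFO)⟩

open IntermediateField in
theorem exists_eq_adjoin_simple_of_algHom {k K : Type*} [Field k] [Field K] [Algebra k K]
    (F : IntermediateField k K) (ι : F →ₐ[k] RatFunc k) : ∃ ψ : K, F = k⟮ψ⟯ := by
  set g := RatFunc.Luroth.generator ι.fieldRange with hg
  have hgF : ι.fieldRange = k⟮g⟯ := RatFunc.Luroth.eq_adjoin_generator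
  obtain ⟨ψ, hψ⟩ : ∃ ψ : F, ι ψ = g := by
    have : g ∈ ι.fieldRange := hgF ▸ mem_adjoin_simple_self k g
    exact this
  refine ⟨ψ, le_antisymm (fun f hf => ?_) (adjoin_simple_le_iff.mpr ψ.2)⟩
  have hmem : ι ⟨f, hf⟩ ∈ k⟮g⟯ := hgF ▸ ⟨⟨f, hf⟩, rfl⟩
  obtain ⟨r, s, hrs⟩ := (mem_adjoin_simple_iff k _).mp hmem
  rw [← hψ, Polynomial.aeval_algHom_apply, Polynomial.aeval_algHom_apply, ← map_div₀] at hrs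
  have h := congrArg Subtype.val (ι.injective hrs)
  refine (mem_adjoin_simple_iff k _).mpr ⟨r, s, h.trans ?_⟩
  have hval : ∀ q : Polynomial k, ((Polynomial.aeval ψ q : F) : K) = Polynomial.aeval (ψ : K) q :=
    fun q => (Polynomial.aeval_algHom_apply F.val ψ q).symm
  rw [← hval, ← hval]
  rfl

/-- A nonconstant rational function `P / Q` takes distinct values at two points where it is
defined. -/
theorem exists_eval_ne_of_notMem_bot {k : Type*} [Field k] [Infinite k] {n : ℕ}
    {P Q : MvPolynomial (Fin n) k} (hQ : Q ≠ 0)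
    (hφ : algebraMap _ (RatFunField k n) P / algebraMap _ (RatFunField k n) Q ∉
      (⊥ : IntermediateField k (RatFunField k n))) :
    ∃ a b : Fin n → k, MvPolynomial.eval a Q ≠ 0 ∧ MvPolynomial.eval b Q ≠ 0 ∧
      MvPolynomial.eval a P / MvPolynomial.eval a Q ≠
        MvPolynomial.eval b P / MvPolynomial.eval b Q := by
  have hex : ∀ R : MvPolynomial (Fin n) k, R ≠ 0 → ∃ a, MvPolynomial.eval a R ≠ 0 := fun R hR => by
    by_contra! h
    exact hR (MvPolynomial.funext fun x => by rw [h, map_zero])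
  obtain ⟨a, ha⟩ := hex Q hQ
  set c := MvPolynomial.eval a P / MvPolynomial.eval a Q with hc
  have hne : (P - MvPolynomial.C c * Q) * Q ≠ 0 := by
    refine mul_ne_zero (fun h0 => hφ ?_) hQ
    rw [sub_eq_zero] at h0
    have hQ' : algebraMap _ (RatFunField k n) Q ≠ 0 :=
      (map_ne_zero_iff _ (IsFractionRing.injective _ _)).mpr hQ
    refine IntermediateField.mem_bot.mpr ⟨c, ?_⟩
    rw [h0, map_mul, mul_div_cancel_right₀ _ hQ', IsScalarTower.algebraMap_apply k
      (MvPolynomial (Fin n) k)]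
    rfl
  obtain ⟨b, hb⟩ := hex _ hne
  rw [map_mul, map_sub, map_mul, MvPolynomial.eval_C] at hb
  refine ⟨a, b, ha, right_ne_zero_of_mul hb, fun h => left_ne_zero_of_mul hb ?_⟩
  rw [← hc, eq_div_iff (right_ne_zero_of_mul hb)] at h
  rw [h, sub_self]

open IntermediateField in
/-- **Lüroth–Gordan**: a subfield of `k(x₁, …, xₙ)` containing a nonconstant `φ` and algebraic
over `k(φ)` is generated by one element. Restriction to a line joining two points at which `φ`
takes different values embeds the subfield into `k(t)`, where Lüroth's theorem applies. -/
theorem exists_eq_adjoin_simple_of_isAlgebraic {k : Type*} [Field k] [Infinite k] {n : ℕ}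
    {φ : RatFunField k n} (hφ : φ ∉ (⊥ : IntermediateField k (RatFunField k n)))
    (F : IntermediateField k (RatFunField k n)) (hF : ∀ f ∈ F, IsAlgebraic k⟮φ⟯ f) :
    ∃ ψ : RatFunField k n, F = k⟮ψ⟯ := by
  obtain ⟨P, Q, hQ, rfl⟩ := IsFractionRing.div_surjective (MvPolynomial (Fin n) k) φ
  obtain ⟨a, b, ha, hb, hab⟩ := exists_eval_ne_of_notMem_bot (nonZeroDivisors.ne_zero hQ) hφ
  let l₀ : MvPolynomial (Fin n) k →ₐ[k] Polynomial k :=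
    MvPolynomial.aeval fun i => Polynomial.C (a i) + Polynomial.X * Polynomial.C (b i - a i)
  have h0 : ∀ R, Polynomial.eval 0 (l₀ R) = MvPolynomial.eval a R := fun R => by
    have : (Polynomial.aeval (0 : k)).comp l₀ = MvPolynomial.aeval a := by
      ext i
      simp [l₀]
    simpa [Polynomial.coe_aeval_eq_eval, MvPolynomial.coe_aeval_eq_eval] using
      DFunLike.congr_fun this R
  have h1 : ∀ R, Polynomial.eval 1 (l₀ R) = MvPolynomial.eval b R := fun R => by
    have : (Polynomial.aeval (1 : k)).comp l₀ = MvPolynomial.aeval b := by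
      ext i
      simp [l₀]
    simpa [Polynomial.coe_aeval_eq_eval, MvPolynomial.coe_aeval_eq_eval] using
      DFunLike.congr_fun this R
  let l : MvPolynomial (Fin n) k →ₐ[k] RatFunc k :=
    (IsScalarTower.toAlgHom k (Polynomial k) (RatFunc k)).comp l₀
  have hl : ∀ R, l R = algebraMap (Polynomial k) (RatFunc k) (l₀ R) := fun R => rfl
  have hinj := IsFractionRing.injective (Polynomial k) (RatFunc k)
  have hQ0 : l₀ Q ≠ 0 := fun h => ha (by rw [← h0, h, Polynomial.eval_zero])
  have hlQ : l Q ≠ 0 := by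
    rw [hl]
    exact (map_ne_zero_iff _ hinj).mpr hQ0
  have htr : Transcendental k (l P / l Q) := by
    refine RatFunc.transcendental_of_ne_C _ ?_
    rintro ⟨c, hc⟩
    rw [div_eq_iff hlQ, hl, hl, ← RatFunc.algebraMap_C, ← map_mul] at hc
    have hc' := hinj hc
    apply hab
    rw [← h0, ← h0, ← h1, ← h1, hc', Polynomial.eval_mul, Polynomial.eval_mul, Polynomial.eval_C,
      Polynomial.eval_C, mul_div_cancel_right₀, mul_div_cancel_right₀]
    · rwa [h1]
    · rwa [h0]
  obtain ⟨ι⟩ := nonempty_algHom_of_transcendental l hlQ htr F hF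
  exact exists_eq_adjoin_simple_of_algHom F ι

/-! ### Automorphisms of `k(ψ)` and linear representations -/

theorem mem_bot_of_isAlgebraic_of_isAlgClosed {k K : Type*} [Field k] [IsAlgClosed k] [Field K]
    [Algebra k K] {x : K} (hx : IsAlgebraic k x) : x ∈ (⊥ : IntermediateField k K) :=
  IntermediateField.mem_bot.mpr (minpoly.mem_range_of_degree_eq_one k x
    (IsAlgClosed.degree_eq_one_of_irreducible k (minpoly.irreducible hx.isIntegral)))

theorem transcendental_of_notMem_bot {k K : Type*} [Field k] [IsAlgClosed k] [Field K]
    [Algebra k K] {x : K} (hx : x ∉ (⊥ : IntermediateField k K)) : Transcendental k x :=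
  fun h => hx (mem_bot_of_isAlgebraic_of_isAlgClosed h)

open IntermediateField in
/-- Two generators of a purely transcendental extension of degree one differ by a Möbius
transformation. -/
theorem exists_moebius_of_mem_adjoin {k K : Type*} [Field k] [IsAlgClosed k] [Field K]
    [Algebra k K] {ψ ψ' : K} (hψ : ψ ∉ (⊥ : IntermediateField k K)) (h : ψ' ∈ k⟮ψ⟯)
    (h' : ψ ∈ k⟮ψ'⟯) : ∃ a b c d : k, a * d - b * c ≠ 0 ∧
      ψ' * (algebraMap k K c * ψ + algebraMap k K d) = algebraMap k K a * ψ + algebraMap k K b := by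
  have htr := transcendental_of_notMem_bot hψ
  let e := RatFunc.algEquivOfTranscendental ψ htr
  set H : RatFunc k := e.symm ⟨ψ', h⟩ with hH
  have heH : e H = ⟨ψ', h⟩ := e.apply_symm_apply _
  have hval : ∀ q : Polynomial k, Polynomial.aeval ψ' q =
      ((e (Polynomial.aeval H q) : k⟮ψ⟯) : K) := fun q => by
    have h1 : e (Polynomial.aeval H q) = Polynomial.aeval (⟨ψ', h⟩ : k⟮ψ⟯) q := by
      rw [← heH]; exact (Polynomial.aeval_algHom_apply e.toAlgHom H q).symm
    rw [h1]
    exact Polynomial.aeval_algHom_apply (k⟮ψ⟯).val (⟨ψ', h⟩ : k⟮ψ⟯) q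
  have htop : k⟮H⟯ = ⊤ := by
    rw [← top_le_iff, ← RatFunc.adjoin_X, adjoin_simple_le_iff, mem_adjoin_simple_iff]
    obtain ⟨r, s, hrs⟩ := (mem_adjoin_simple_iff k ψ).mp h'
    refine ⟨r, s, e.injective (Subtype.ext ?_)⟩
    rw [map_div₀, RatFunc.algEquivOfTranscendental_X]
    rw [hval, hval] at hrs
    exact hrs
  have hdeg := RatFunc.finrank_eq_max_natDegree H
  rw [finrank_eq_one_iff_eq_top.mpr htop] at hdeg
  obtain ⟨a, b, hnum⟩ := Polynomial.exists_eq_X_add_C_of_natDegree_le_one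
    (hdeg ▸ le_max_left _ _ : H.num.natDegree ≤ 1)
  obtain ⟨c, d, hden⟩ := Polynomial.exists_eq_X_add_C_of_natDegree_le_one
    (hdeg ▸ le_max_right _ _ : H.denom.natDegree ≤ 1)
  have hden0 : Polynomial.aeval ψ H.denom ≠ 0 := fun h0 =>
    H.denom_ne_zero ((transcendental_iff.mp htr) _ h0)
  have hψ' : ψ' = Polynomial.aeval ψ H.num / Polynomial.aeval ψ H.denom := by
    have := RatFunc.algEquivOfTranscendental_apply ψ htr H
    rw [← this]
    exact (congrArg Subtype.val heH).symm
  rw [eq_div_iff hden0, hnum] at hψ'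
  rw [hden] at hψ' hden0
  simp only [map_add, map_mul, Polynomial.aeval_C, Polynomial.aeval_X] at hψ' hden0
  refine ⟨a, b, c, d, fun hdet => ?_, hψ'⟩
  have hψ'bot : ψ' ∉ (⊥ : IntermediateField k K) := fun hb => hψ (by
    have : k⟮ψ'⟯ = ⊥ := adjoin_simple_eq_bot_iff.mpr hb
    exact this ▸ h')
  apply hψ'bot
  have hdet' : algebraMap k K a * algebraMap k K d = algebraMap k K b * algebraMap k K c := by
    rw [← map_mul, ← map_mul, sub_eq_zero.mp hdet]
  rw [mem_bot]
  by_cases hc : c = 0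
  · have hd : d ≠ 0 := by
      rintro rfl
      simp [hc] at hden0
    have ha : a = 0 := by
      rw [hc, mul_zero, sub_zero] at hdet
      exact (mul_eq_zero.mp hdet).resolve_right hd
    refine ⟨b / d, ?_⟩
    have hd' : algebraMap k K d ≠ 0 := (map_ne_zero _).mpr hd
    rw [map_div₀, div_eq_iff hd']
    simpa [ha, hc] using hψ'.symm
  · refine ⟨a / c, ?_⟩
    have hc' : algebraMap k K c ≠ 0 := (map_ne_zero _).mpr hc
    rw [map_div₀, div_eq_iff hc']
    apply mul_right_cancel₀ hden0
    linear_combination - algebraMap k K c * hψ' + hdet'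

theorem isUnit_eq_C {k : Type*} [Field k] {n : ℕ} {u : MvPolynomial (Fin n) k} (hu : IsUnit u) :
    ∃ r : k, r ≠ 0 ∧ u = MvPolynomial.C r := by
  obtain ⟨r, hr, h⟩ := MvPolynomial.isUnit_iff_eq_C_of_isReduced.mp hu
  exact ⟨r, hr.ne_zero, h⟩

theorem ratFunAction_algebraMap {k : Type*} [Field k] {n : ℕ} (g : GL (Fin n) k)
    (P : MvPolynomial (Fin n) k) : ratFunAction k n g (algebraMap _ (RatFunField k n) P) =
      algebraMap _ (RatFunField k n) (polyAction k n g P) := by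
  simp [ratFunAction]

theorem mem_invariantSubfield_iff {k : Type*} [Field k] {n : ℕ} {G : Subgroup (GL (Fin n) k)}
    {x : RatFunField k n} : x ∈ invariantSubfield G ↔ ∀ g : G, ratFunAction k n g x = x := by
  rw [invariantSubfield, IntermediateField.mem_fixedField_iff]
  constructor
  · intro h g
    exact h _ ⟨g, g.2, rfl⟩
  · rintro h _ ⟨g, hg, rfl⟩
    exact h ⟨g, hg⟩

/-- If a Möbius transformation with coefficients in `k` carries the reduced fraction `P / Q` to
the reduced fraction `P' / Q'`, then `P'` and `Q'` are linear combinations of `P` and `Q`. -/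
theorem exists_linear_of_moebius {k : Type*} [Field k] {n : ℕ}
    {P Q P' Q' : MvPolynomial (Fin n) k} (hPQ : IsRelPrime P Q) (hPQ' : IsRelPrime P' Q')
    (hQ' : Q' ≠ 0) {a b c d : k} (hdet : a * d - b * c ≠ 0)
    (h : P' * (MvPolynomial.C c * P + MvPolynomial.C d * Q) =
      Q' * (MvPolynomial.C a * P + MvPolynomial.C b * Q)) :
    ∃ r : k, P' = MvPolynomial.C (r * a) * P + MvPolynomial.C (r * b) * Q ∧
      Q' = MvPolynomial.C (r * c) * P + MvPolynomial.C (r * d) * Q := by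
  obtain ⟨u, hu⟩ : Q' ∣ MvPolynomial.C c * P + MvPolynomial.C d * Q :=
    hPQ'.symm.dvd_of_dvd_mul_left ⟨_, h⟩
  have hu' : MvPolynomial.C a * P + MvPolynomial.C b * Q = P' * u := by
    apply mul_left_cancel₀ hQ'
    rw [← h, hu]
    ring
  have hC : MvPolynomial.C (a * d - b * c) * MvPolynomial.C (a * d - b * c)⁻¹ =
      (1 : MvPolynomial (Fin n) k) := by
    rw [← MvPolynomial.C_mul, mul_inv_cancel₀ hdet, MvPolynomial.C_1]
  have hd : (MvPolynomial.C (a * d - b * c) : MvPolynomial (Fin n) k) =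
      MvPolynomial.C a * MvPolynomial.C d - MvPolynomial.C b * MvPolynomial.C c := by
    simp
  -- by Cramer's rule, `u` divides both `P` and `Q`
  have huP : u ∣ P := ⟨(P' * MvPolynomial.C d - Q' * MvPolynomial.C b) *
      MvPolynomial.C (a * d - b * c)⁻¹, by
    linear_combination (-P) * hC + P * MvPolynomial.C (a * d - b * c)⁻¹ * hd +
      MvPolynomial.C (a * d - b * c)⁻¹ * (MvPolynomial.C d * hu' - MvPolynomial.C b * hu)⟩
  have huQ : u ∣ Q := ⟨(Q' * MvPolynomial.C a - P' * MvPolynomial.C c) *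
      MvPolynomial.C (a * d - b * c)⁻¹, by
    linear_combination (-Q) * hC + Q * MvPolynomial.C (a * d - b * c)⁻¹ * hd +
      MvPolynomial.C (a * d - b * c)⁻¹ * (MvPolynomial.C a * hu - MvPolynomial.C c * hu')⟩
  obtain ⟨s, hs, rfl⟩ := isUnit_eq_C (hPQ huP huQ)
  have hsC : MvPolynomial.C s⁻¹ * MvPolynomial.C s = (1 : MvPolynomial (Fin n) k) := by
    rw [← MvPolynomial.C_mul, inv_mul_cancel₀ hs, MvPolynomial.C_1]
  refine ⟨s⁻¹, ?_, ?_⟩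
  · rw [MvPolynomial.C_mul, MvPolynomial.C_mul]
    linear_combination (-P') * hsC - MvPolynomial.C s⁻¹ * hu'
  · rw [MvPolynomial.C_mul, MvPolynomial.C_mul]
    linear_combination (-Q') * hsC - MvPolynomial.C s⁻¹ * hu

open IntermediateField in
/-- A linear substitution which preserves the field `k(P / Q)`, with `P` and `Q` coprime,
preserves the linear span of `P` and `Q`. -/
theorem exists_linear_of_preserves {k : Type*} [Field k] [IsAlgClosed k] {n : ℕ}
    {P Q : MvPolynomial (Fin n) k} (hPQ : IsRelPrime P Q) (hQ : Q ≠ 0) {ψ : RatFunField k n}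
    (hψPQ : ψ = algebraMap _ (RatFunField k n) P / algebraMap _ (RatFunField k n) Q)
    (hψ : ψ ∉ (⊥ : IntermediateField k (RatFunField k n))) {g : GL (Fin n) k}
    (hg : ratFunAction k n g ψ ∈ k⟮ψ⟯) (hg' : ratFunAction k n g⁻¹ ψ ∈ k⟮ψ⟯) :
    ∃ M : Matrix (Fin 2) (Fin 2) k,
      polyAction k n g P = MvPolynomial.C (M 0 0) * P + MvPolynomial.C (M 0 1) * Q ∧
      polyAction k n g Q = MvPolynomial.C (M 1 0) * P + MvPolynomial.C (M 1 1) * Q := by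
  have hinj := IsFractionRing.injective (MvPolynomial (Fin n) k) (RatFunField k n)
  have hQ0 : algebraMap _ (RatFunField k n) Q ≠ 0 := (map_ne_zero_iff _ hinj).mpr hQ
  have hgQ : polyAction k n g Q ≠ 0 := (map_ne_zero_iff _ (polyAction k n g).injective).mpr hQ
  have hgQ0 : algebraMap _ (RatFunField k n) (polyAction k n g Q) ≠ 0 :=
    (map_ne_zero_iff _ hinj).mpr hgQ
  have hback : ψ ∈ k⟮ratFunAction k n g ψ⟯ := by
    obtain ⟨r, s, hrs⟩ := (mem_adjoin_simple_iff k _).mp hg'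
    refine (mem_adjoin_simple_iff k _).mpr ⟨r, s, ?_⟩
    have h1 := congrArg (ratFunAction k n g) hrs
    rw [← AlgEquiv.mul_apply, ← map_mul, mul_inv_cancel, map_one, map_div₀] at h1
    have hval : ∀ q : Polynomial k, Polynomial.aeval (ratFunAction k n g ψ) q =
        ratFunAction k n g (Polynomial.aeval ψ q) := fun q =>
      Polynomial.aeval_algHom_apply (ratFunAction k n g).toAlgHom ψ q
    rw [hval, hval]
    exact h1
  obtain ⟨a, b, c, d, hdet, habcd⟩ := exists_moebius_of_mem_adjoin hψ hg hback
  have hrel : IsRelPrime (polyAction k n g P) (polyAction k n g Q) := by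
    intro u hu hu'
    have h1 : (polyAction k n g).symm u ∣ P := by
      simpa using map_dvd (polyAction k n g).symm hu
    have h2 : (polyAction k n g).symm u ∣ Q := by
      simpa using map_dvd (polyAction k n g).symm hu'
    have := (hPQ h1 h2).map (polyAction k n g)
    simpa using this
  have hC : ∀ t : k, algebraMap k (RatFunField k n) t =
      algebraMap _ (RatFunField k n) (MvPolynomial.C t : MvPolynomial (Fin n) k) := fun t =>
    IsScalarTower.algebraMap_apply k (MvPolynomial (Fin n) k) (RatFunField k n) t
  obtain ⟨r, h1, h2⟩ := exists_linear_of_moebius hPQ hrel hgQ hdet (hinj (by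
    rw [hψPQ, map_div₀, ratFunAction_algebraMap, ratFunAction_algebraMap, hC, hC, hC, hC] at habcd
    field_simp at habcd
    simp only [map_mul, map_add]
    linear_combination habcd))
  exact ⟨!![r * a, r * b; r * c, r * d], by simpa using h1, by simpa using h2⟩

/-! ### Saturation from the condition on factor groups -/

theorem isPerfect_of_forall_quotient {G : Type*} [Group G]
    (h : ∀ (N : Subgroup G) [N.Normal], (∀ a b : G ⧸ N, a * b = b * a) → Subsingleton (G ⧸ N)) :
    Group.IsPerfect G := by
  refine ⟨?_⟩
  have := h (commutator G) (fun a b => mul_comm (G := Abelianization G) a b)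
  exact QuotientGroup.subgroup_eq_top_of_subsingleton _ this

/-- A homomorphism to `GL₂` from a finite perfect group without binary icosahedral factor groups
is trivial. -/
theorem matrix_hom_eq_one {k : Type*} [Field k] [CharZero k] {G : Type*} [Group G] [Finite G]
    [Group.IsPerfect G] (h : ∀ (N : Subgroup G) [N.Normal], ¬ IsBinaryIcosahedral (G ⧸ N))
    (ρ : G →* Matrix (Fin 2) (Fin 2) k) (g : G) : ρ g = 1 := by
  have hdet : ∀ g, (ρ g).det = 1 := fun g => by
    have := eq_one_of_isPerfect_of_isSolvable
      (((Matrix.detMonoidHom : Matrix (Fin 2) (Fin 2) k →* k).comp ρ).toHomUnits) g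
    exact congrArg Units.val this
  let σ : G →* SL(2, k) :=
    { toFun := fun g => ⟨ρ g, hdet g⟩
      map_one' := Subtype.ext (map_one ρ)
      map_mul' := fun x y => Subtype.ext (map_mul ρ x y) }
  by_contra hne
  have hnt : Nontrivial (G ⧸ σ.ker) := by
    refine ⟨⟨(g : G ⧸ σ.ker), 1, fun h1 => hne ?_⟩⟩
    have h2 : σ g = 1 := (QuotientGroup.eq_one_iff g).mp h1
    exact congrArg Subtype.val h2
  exact h σ.ker (isBinaryIcosahedral_of_injective (QuotientGroup.kerLift σ)
    (QuotientGroup.kerLift_injective σ))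

open IntermediateField in
/-- If `k(ψ)` is stable under a finite perfect group `G` without binary icosahedral factor groups,
then `G` fixes `ψ`: writing `ψ = P / Q` in lowest terms, `G` acts linearly on the span of `P` and
`Q`. -/
theorem mem_invariantSubfield_of_stable {k : Type*} [Field k] [IsAlgClosed k] [CharZero k] {n : ℕ}
    {G : Subgroup (GL (Fin n) k)} [Finite G] [Group.IsPerfect G]
    (hI : ∀ (N : Subgroup G) [N.Normal], ¬ IsBinaryIcosahedral (G ⧸ N)) {ψ : RatFunField k n}
    (hψ : ψ ∉ (⊥ : IntermediateField k (RatFunField k n)))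
    (hstab : ∀ g : G, ratFunAction k n g ψ ∈ k⟮ψ⟯) : ψ ∈ invariantSubfield G := by
  obtain ⟨P, ⟨Q, hQ⟩, hPQ, hfrac⟩ :=
    IsFractionRing.exists_reduced_fraction (MvPolynomial (Fin n) k) ψ
  have hψPQ : ψ = algebraMap _ (RatFunField k n) P / algebraMap _ (RatFunField k n) Q := by
    rw [← hfrac, IsFractionRing.mk'_eq_div]
  have hQ0 : Q ≠ 0 := nonZeroDivisors.ne_zero hQ
  choose M hMP hMQ using fun g : G => exists_linear_of_preserves hPQ hQ0 hψPQ hψ (hstab g)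
    (hstab g⁻¹)
  have hinj := IsFractionRing.injective (MvPolynomial (Fin n) k) (RatFunField k n)
  -- `P` and `Q` are linearly independent over `k`
  have hind : ∀ a b a' b' : k, MvPolynomial.C a * P + MvPolynomial.C b * Q =
      MvPolynomial.C a' * P + MvPolynomial.C b' * Q → a = a' ∧ b = b' := by
    intro a b a' b' hab
    have hC : MvPolynomial.C (a - a') * P = MvPolynomial.C (b' - b) * Q := by
      rw [MvPolynomial.C_sub, MvPolynomial.C_sub]
      linear_combination hab
    have haa : a - a' = 0 := by
      by_contra hne
      apply hψ
      refine IntermediateField.mem_bot.mpr ⟨(b' - b) / (a - a'), ?_⟩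
      have hne' : algebraMap k (RatFunField k n) (a - a') ≠ 0 := (map_ne_zero _).mpr hne
      have h1 := congrArg (algebraMap _ (RatFunField k n)) hC
      rw [map_mul, map_mul] at h1
      rw [hψPQ, map_div₀, div_eq_div_iff hne' ((map_ne_zero_iff _ hinj).mpr hQ0),
        IsScalarTower.algebraMap_apply k (MvPolynomial (Fin n) k) (RatFunField k n),
        IsScalarTower.algebraMap_apply k (MvPolynomial (Fin n) k) (RatFunField k n)]
      exact h1.symm.trans (mul_comm _ _)
    rw [haa, MvPolynomial.C_0, zero_mul] at hC
    have hbb := (mul_eq_zero.mp hC.symm).resolve_right hQ0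
    rw [← MvPolynomial.C_0, MvPolynomial.C_inj] at hbb
    exact ⟨sub_eq_zero.mp haa, (sub_eq_zero.mp hbb).symm⟩
  have hCact : ∀ (g : G) (t : k), polyAction k n g (MvPolynomial.C t) = MvPolynomial.C t :=
    fun g t => (polyAction k n g).commutes t
  have huniq : ∀ (g : G) (N : Matrix (Fin 2) (Fin 2) k),
      polyAction k n g P = MvPolynomial.C (N 0 0) * P + MvPolynomial.C (N 0 1) * Q →
      polyAction k n g Q = MvPolynomial.C (N 1 0) * P + MvPolynomial.C (N 1 1) * Q → M g = N := by
    intro g N h1 h2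
    obtain ⟨e1, e2⟩ := hind _ _ _ _ ((hMP g).symm.trans h1)
    obtain ⟨e3, e4⟩ := hind _ _ _ _ ((hMQ g).symm.trans h2)
    ext i j
    fin_cases i <;> fin_cases j <;> assumption
  have hMone : M 1 = 1 := huniq 1 1 (by simp) (by simp)
  -- matrices of row vectors multiply in the opposite order
  have hMmul : ∀ g h : G, M (g * h) = M h * M g := fun g h => by
    apply huniq
    · rw [Subgroup.coe_mul, map_mul, AlgEquiv.mul_apply, hMP h, map_add, map_mul, map_mul, hCact,
        hCact, hMP g, hMQ g, Matrix.mul_apply, Matrix.mul_apply, Fin.sum_univ_two,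
        Fin.sum_univ_two]
      simp only [MvPolynomial.C_add, MvPolynomial.C_mul]
      ring
    · rw [Subgroup.coe_mul, map_mul, AlgEquiv.mul_apply, hMQ h, map_add, map_mul, map_mul, hCact,
        hCact, hMP g, hMQ g, Matrix.mul_apply, Matrix.mul_apply, Fin.sum_univ_two,
        Fin.sum_univ_two]
      simp only [MvPolynomial.C_add, MvPolynomial.C_mul]
      ring
  let ρ : G →* Matrix (Fin 2) (Fin 2) k :=
    { toFun := fun g => M g⁻¹
      map_one' := by rw [inv_one, hMone]
      map_mul' := fun x y => by rw [mul_inv_rev, hMmul] }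
  have hM : ∀ g, M g = 1 := fun g => by
    have := matrix_hom_eq_one hI ρ g⁻¹
    change M g⁻¹⁻¹ = 1 at this
    rwa [inv_inv] at this
  refine mem_invariantSubfield_iff.mpr fun g => ?_
  rw [hψPQ, map_div₀, ratFunAction_algebraMap, ratFunAction_algebraMap, hMP g, hMQ g, hM g]
  simp

open IntermediateField in
/-- The algebraic closure of `k(φ)` in `K`, as an extension of `k`. -/
def relAlgClosure (k : Type*) {K : Type*} [Field k] [Field K] [Algebra k K] (φ : K) :
    IntermediateField k K :=
  (algebraicClosure k⟮φ⟯ K).restrictScalars k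

open IntermediateField in
theorem mem_relAlgClosure_iff {k K : Type*} [Field k] [Field K] [Algebra k K] {φ f : K} :
    f ∈ relAlgClosure k φ ↔ IsAlgebraic k⟮φ⟯ f :=
  mem_algebraicClosure_iff

open IntermediateField in
theorem self_mem_relAlgClosure {k K : Type*} [Field k] [Field K] [Algebra k K] (φ : K) :
    φ ∈ relAlgClosure k φ :=
  mem_relAlgClosure_iff.mpr (isAlgebraic_algebraMap (⟨φ, mem_adjoin_simple_self k φ⟩ : k⟮φ⟯))

open IntermediateField in
theorem isAlgClosedInside_relAlgClosure {k K : Type*} [Field k] [Field K] [Algebra k K] (φ : K) :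
    IsAlgClosedInside (relAlgClosure k φ) := by
  intro f hf
  have hf' : IsAlgebraic (algebraicClosure k⟮φ⟯ K) f := hf
  exact mem_relAlgClosure_iff.mpr (hf'.restrictScalars k⟮φ⟯)

open IntermediateField in
theorem map_mem_relAlgClosure {k K : Type*} [Field k] [Field K] [Algebra k K] {φ f : K}
    (σ : K ≃ₐ[k] K) (hσ : σ φ = φ) (hf : f ∈ relAlgClosure k φ) : σ f ∈ relAlgClosure k φ := by
  rw [mem_relAlgClosure_iff] at hf ⊢
  have hfix : ∀ x : k⟮φ⟯, σ x = x := fun x => by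
    obtain ⟨r, s, hrs⟩ := (mem_adjoin_simple_iff k _).mp x.2
    have hval : ∀ q : Polynomial k, σ (Polynomial.aeval φ q) = Polynomial.aeval φ q := fun q =>
      (Polynomial.aeval_algHom_apply σ.toAlgHom φ q).symm.trans
        (congrArg (fun y => Polynomial.aeval y q) hσ)
    rw [hrs, map_div₀, hval, hval]
  let τ : K →ₐ[k⟮φ⟯] K := { σ.toAlgHom.toRingHom with commutes' := hfix }
  exact hf.algHom τ

open IntermediateField in
/-- The generative element of `φ` is the Lüroth–Gordan generator of the algebraic closure of
`k(φ)`. -/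
theorem isSaturated_invariantSubfield {k : Type*} [Field k] [IsAlgClosed k] [CharZero k] {n : ℕ}
    (G : Subgroup (GL (Fin n) k)) [Finite G] [Group.IsPerfect G]
    (hI : ∀ (N : Subgroup G) [N.Normal], ¬ IsBinaryIcosahedral (G ⧸ N)) :
    IsSaturated (invariantSubfield G) := by
  intro φ hφG hφ
  obtain ⟨ψ, hψ⟩ := exists_eq_adjoin_simple_of_isAlgebraic hφ (relAlgClosure k φ)
    fun f hf => mem_relAlgClosure_iff.mp hf
  have hφψ : φ ∈ k⟮ψ⟯ := hψ ▸ self_mem_relAlgClosure φ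
  have hψψ : ψ ∈ relAlgClosure k φ := hψ ▸ mem_adjoin_simple_self k ψ
  have hψbot : ψ ∉ (⊥ : IntermediateField k (RatFunField k n)) := fun hb => hφ (by
    rwa [adjoin_simple_eq_bot_iff.mpr hb] at hφψ)
  refine ⟨ψ, mem_invariantSubfield_of_stable hI hψbot fun g => ?_, ⟨hψbot, ?_⟩, hφψ⟩
  · rw [← hψ]
    exact map_mem_relAlgClosure _ (mem_invariantSubfield_iff.mp hφG g) hψψ
  · rw [← hψ]
    exact isAlgClosedInside_relAlgClosure φ

/-! ### The condition on factor groups from saturation -/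

open IntermediateField in
/-- In a simple extension `k(ψ)`, the generator is algebraic over `k(φ)` for any nonconstant
`φ`. -/
theorem isAlgebraic_adjoin_of_mem_adjoin {k K : Type*} [Field k] [Field K] [Algebra k K] {φ ψ : K}
    (hφ : φ ∉ (⊥ : IntermediateField k K)) (h : φ ∈ k⟮ψ⟯) : IsAlgebraic k⟮φ⟯ ψ := by
  obtain ⟨r, s, hrs⟩ := (mem_adjoin_simple_iff k φ).mp h
  have hs : Polynomial.aeval ψ s ≠ 0 := by
    intro h0
    rw [h0, div_zero] at hrs
    exact hφ (hrs ▸ zero_mem _)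
  let φ' : k⟮φ⟯ := ⟨φ, mem_adjoin_simple_self k φ⟩
  refine ⟨r.map (algebraMap k k⟮φ⟯) - Polynomial.C φ' * s.map (algebraMap k k⟮φ⟯), fun h0 => ?_, ?_⟩
  · obtain ⟨i, hi⟩ : ∃ i, s.coeff i ≠ 0 := by
      by_contra! hall
      exact hs (by rw [Polynomial.ext (q := 0) hall, map_zero])
    have h1 := congrArg (fun p => ((Polynomial.coeff p i : k⟮φ⟯) : K)) h0
    simp only [Polynomial.coeff_sub, Polynomial.coeff_map, Polynomial.coeff_C_mul,
      Polynomial.coeff_zero] at h1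
    have h2 : algebraMap k K (r.coeff i) - φ * algebraMap k K (s.coeff i) = 0 := h1
    refine hφ (mem_bot.mpr ⟨r.coeff i / s.coeff i, ?_⟩)
    rw [map_div₀, div_eq_iff ((map_ne_zero _).mpr hi)]
    exact sub_eq_zero.mp h2
  · rw [map_sub, map_mul, Polynomial.aeval_map_algebraMap, Polynomial.aeval_map_algebraMap,
      Polynomial.aeval_C]
    change _ - φ * _ = 0
    rw [hrs, div_mul_cancel₀ _ hs, sub_self]

open IntermediateField in
/-- If the field of invariants is saturated, then any `ψ` for which `k(ψ)` is stable under `G` is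
invariant: some coefficient `φ` of `∏ (T - g ψ)` is a nonconstant invariant in `k(ψ)`, and a
generative element `ψ'` of `φ` satisfies `ψ ∈ k(ψ')`. -/
theorem mem_invariantSubfield_of_isSaturated {k : Type*} [Field k] [IsAlgClosed k] {n : ℕ}
    {G : Subgroup (GL (Fin n) k)} [Finite G] (hsat : IsSaturated (invariantSubfield G))
    {ψ : RatFunField k n} (hstab : ∀ g : G, ratFunAction k n g ψ ∈ k⟮ψ⟯) :
    ψ ∈ invariantSubfield G := by
  by_cases hψ : ψ ∈ (⊥ : IntermediateField k (RatFunField k n))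
  · exact bot_le (a := invariantSubfield G) hψ
  have := Fintype.ofFinite G
  let p : Polynomial (RatFunField k n) :=
    ∏ g : G, (Polynomial.X - Polynomial.C (ratFunAction k n g ψ))
  have hpinv : ∀ i, p.coeff i ∈ invariantSubfield G := fun i => by
    rw [mem_invariantSubfield_iff]
    intro g
    have hp : p.map (ratFunAction k n g).toAlgHom.toRingHom = p := by
      simp only [p, Polynomial.map_prod, Polynomial.map_sub, Polynomial.map_X, Polynomial.map_C]
      refine Fintype.prod_equiv (Equiv.mulLeft g) _ _ fun h => ?_
      rw [Equiv.coe_mulLeft, Subgroup.coe_mul, map_mul]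
      rfl
    conv_rhs => rw [← hp, Polynomial.coeff_map]
    rfl
  have hpmem : ∀ i, p.coeff i ∈ k⟮ψ⟯ := fun i => by
    have hp : p = (∏ g : G, (Polynomial.X - Polynomial.C
        (⟨ratFunAction k n g ψ, hstab g⟩ : k⟮ψ⟯))).map (algebraMap k⟮ψ⟯ (RatFunField k n)) := by
      simp only [p, Polynomial.map_prod, Polynomial.map_sub, Polynomial.map_X, Polynomial.map_C]
      rfl
    rw [hp, Polynomial.coeff_map]
    exact Subtype.property _
  have hproot : p.eval ψ = 0 := by
    rw [Polynomial.eval_prod]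
    refine Finset.prod_eq_zero (Finset.mem_univ 1) ?_
    simp
  have hpmonic : p.Monic := Polynomial.monic_prod_X_sub_C _ _
  obtain ⟨i, hi⟩ : ∃ i, p.coeff i ∉ (⊥ : IntermediateField k (RatFunField k n)) := by
    by_contra! hall
    have hlift : p ∈ Polynomial.lifts (algebraMap k (RatFunField k n)) := by
      rw [Polynomial.lifts_iff_coeff_lifts]
      exact fun i => mem_bot.mp (hall i)
    obtain ⟨q, hq⟩ := (Polynomial.mem_lifts p).mp hlift
    refine hψ (mem_bot_of_isAlgebraic_of_isAlgClosed ⟨q, ?_, ?_⟩)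
    · rintro rfl
      rw [Polynomial.map_zero] at hq
      exact hpmonic.ne_zero hq.symm
    · rw [← hproot, ← hq, Polynomial.eval_map_algebraMap]
  obtain ⟨ψ', hψ'G, ⟨-, hclosed⟩, hφψ'⟩ := hsat _ (hpinv i) hi
  have halg := isAlgebraic_adjoin_of_mem_adjoin hi (hpmem i)
  have hψψ' : ψ ∈ k⟮ψ'⟯ := hclosed ψ (IsAlgebraic.tower_top_of_subalgebra_le
    (adjoin_simple_le_iff.mpr hφψ') halg)
  exact adjoin_simple_le_iff.mpr hψ'G hψψ'

theorem ratFunAction_injective (k : Type*) [Field k] (n : ℕ) :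
    Function.Injective (ratFunAction k n) := by
  refine (IsFractionRing.fieldEquivOfAlgEquivHom_injective _ _ k (RatFunField k n)).comp ?_
  rw [injective_iff_map_eq_one]
  intro g hg
  rw [← inv_eq_one]
  ext i j
  have h1 : polyAction k n g (MvPolynomial.X i) = MvPolynomial.X i := by rw [hg]; rfl
  have h2 : linearSubst (g⁻¹ : GL (Fin n) k).val (MvPolynomial.X i) = MvPolynomial.X i := h1
  rw [linearSubst, MvPolynomial.aeval_X] at h2
  have h3 := congrArg (MvPolynomial.eval (Pi.single j 1)) h2
  simpa [Pi.single_apply, Matrix.one_apply] using h3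

/-- Dedekind's independence of the automorphisms `f ↦ g f`. -/
theorem exists_sum_smul_ne_zero {k : Type*} [Field k] {n : ℕ} (G : Subgroup (GL (Fin n) k))
    [Fintype G] {c : G → RatFunField k n} (hc : c ≠ 0) :
    ∃ f : RatFunField k n, ∑ g : G, c g * ratFunAction k n g f ≠ 0 := by
  by_contra! h
  have hli := linearIndependent_toLinearMap k (RatFunField k n) (RatFunField k n)
  have hinj : Function.Injective fun g : G => (ratFunAction k n g).toAlgHom := fun a b hab =>
    Subtype.ext (ratFunAction_injective k n (AlgEquiv.coe_toAlgHom_injective hab))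
  have := Fintype.linearIndependent_iff.mp (hli.comp _ hinj) c (LinearMap.ext fun f => by
    simpa using h f)
  exact hc (funext this)

/-- A nontrivial character of `G` has a nonzero semi-invariant in `k(x₁, …, xₙ)`, which generates
a `G`-stable subfield without being invariant. -/
theorem subsingleton_quotient_of_isSaturated {k : Type*} [Field k] [IsAlgClosed k] [CharZero k]
    {n : ℕ} {G : Subgroup (GL (Fin n) k)} [Finite G] (hsat : IsSaturated (invariantSubfield G))
    (N : Subgroup G) [N.Normal] (hab : ∀ a b : G ⧸ N, a * b = b * a) : Subsingleton (G ⧸ N) := by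
  by_contra hns
  rw [not_subsingleton_iff_nontrivial] at hns
  let : CommGroup (G ⧸ N) := { (inferInstance : Group (G ⧸ N)) with mul_comm := hab }
  obtain ⟨x, hx⟩ := exists_ne (1 : G ⧸ N)
  obtain ⟨χ, hχ⟩ := CommGroup.exists_apply_ne_one_of_hasEnoughRootsOfUnity (G ⧸ N) k hx
  obtain ⟨g₀, rfl⟩ := QuotientGroup.mk_surjective x
  let θ : G →* k := (Units.coeHom k).comp (χ.comp (QuotientGroup.mk' N))
  have hθ : θ g₀ ≠ 1 := fun h => hχ (Units.ext h)
  have := Fintype.ofFinite G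
  obtain ⟨f, hf⟩ := exists_sum_smul_ne_zero G
    (c := fun g => algebraMap k (RatFunField k n) (θ g⁻¹)) (fun h => by
      have := congrFun h 1
      simp at this)
  set ψ := ∑ g : G, algebraMap k (RatFunField k n) (θ g⁻¹) * ratFunAction k n g f with hψ
  have hact : ∀ g : G, ratFunAction k n g ψ = algebraMap k (RatFunField k n) (θ g) * ψ := by
    intro g
    rw [hψ, map_sum, Finset.mul_sum]
    refine Fintype.sum_equiv (Equiv.mulLeft g) _ _ fun h => ?_
    have hθh : θ h⁻¹ = θ g * θ (g * h)⁻¹ := by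
      rw [mul_inv_rev, map_mul, mul_left_comm, ← map_mul θ g, mul_inv_cancel, map_one, mul_one]
    rw [Equiv.coe_mulLeft, Subgroup.coe_mul, map_mul, map_mul, AlgEquiv.commutes, ← mul_assoc,
      ← map_mul, hθh]
    rfl
  have hinv := mem_invariantSubfield_iff.mp (mem_invariantSubfield_of_isSaturated hsat fun g => by
    rw [hact]
    exact mul_mem (IntermediateField.algebraMap_mem _ _)
      (IntermediateField.mem_adjoin_simple_self k ψ)) g₀
  rw [hact, mul_eq_right₀ hf] at hinv
  exact hθ ((algebraMap k (RatFunField k n)).injective (hinv.trans (map_one _).symm))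

/-- If the field of invariants is saturated and `G` is perfect, no two-dimensional representation
of `G` takes the value `-1`: realize it inside `k(x₁, …, xₙ)` on the span of `ψ₀` and `ψ₁`. Then
`ψ₁ / ψ₀` is invariant, so `ψ₀` spans a one-dimensional representation over the field of
invariants, which is trivial as `G` is perfect. -/
theorem ne_neg_one_of_isSaturated {k : Type*} [Field k] [IsAlgClosed k] [CharZero k]
    {n : ℕ} {G : Subgroup (GL (Fin n) k)} [Finite G] [Group.IsPerfect G]
    (hsat : IsSaturated (invariantSubfield G)) (ρ : G →* Matrix (Fin 2) (Fin 2) k) (g₀ : G) :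
    ρ g₀ ≠ -1 := by
  intro hg₀
  have := Fintype.ofFinite G
  let c : Fin 2 → G → RatFunField k n := fun i g => algebraMap k (RatFunField k n) (ρ g i 0)
  obtain ⟨f, hf⟩ := exists_sum_smul_ne_zero G (c := c 0) (fun h => by
    have := congrFun h 1
    simp [c] at this)
  let ψ : Fin 2 → RatFunField k n := fun i => ∑ g : G, c i g * ratFunAction k n g f
  have hψ0 : ψ 0 ≠ 0 := hf
  have hact : ∀ (g : G) (i : Fin 2), ratFunAction k n g (ψ i) =
      algebraMap k (RatFunField k n) (ρ g⁻¹ i 0) * ψ 0 +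
        algebraMap k (RatFunField k n) (ρ g⁻¹ i 1) * ψ 1 := by
    intro g i
    simp only [ψ]
    rw [map_sum, Finset.mul_sum, Finset.mul_sum, ← Finset.sum_add_distrib]
    refine Fintype.sum_equiv (Equiv.mulLeft g) _ _ fun h => ?_
    have hρ : ρ h i 0 = ρ g⁻¹ i 0 * ρ (g * h) 0 0 + ρ g⁻¹ i 1 * ρ (g * h) 1 0 := by
      rw [← Fin.sum_univ_two (fun j => ρ g⁻¹ i j * ρ (g * h) j 0), ← Matrix.mul_apply, ← map_mul,
        inv_mul_cancel_left]
    have hgh : ratFunAction k n (g * h : G) f = ratFunAction k n g (ratFunAction k n h f) := by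
      rw [Subgroup.coe_mul, map_mul]
      rfl
    simp only [c]
    rw [Equiv.coe_mulLeft, hgh, map_mul, AlgEquiv.commutes, hρ, map_add,
      map_mul (algebraMap k _), map_mul (algebraMap k _)]
    ring
  obtain ⟨t, ht⟩ : ∃ t, t = ψ 1 / ψ 0 := ⟨_, rfl⟩
  have hψ1 : ψ 1 = t * ψ 0 := by rw [ht, div_mul_cancel₀ _ hψ0]
  have hmul : ∀ (g : G) (i : Fin 2), ratFunAction k n g (ψ i) =
      (algebraMap k (RatFunField k n) (ρ g⁻¹ i 0) +
        algebraMap k (RatFunField k n) (ρ g⁻¹ i 1) * t) * ψ 0 := fun g i => by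
    rw [hact, hψ1]
    ring
  have ht_inv : ∀ g : G, ratFunAction k n g t = t := by
    refine mem_invariantSubfield_iff.mp (mem_invariantSubfield_of_isSaturated hsat fun g => ?_)
    rw [ht, map_div₀, ← ht, hmul, hmul, mul_div_mul_right _ _ hψ0]
    have hmem := IntermediateField.mem_adjoin_simple_self k t
    exact div_mem
      (add_mem (IntermediateField.algebraMap_mem _ _)
        (mul_mem (IntermediateField.algebraMap_mem _ _) hmem))
      (add_mem (IntermediateField.algebraMap_mem _ _)
        (mul_mem (IntermediateField.algebraMap_mem _ _) hmem))
  let μ : G → RatFunField k n := fun g => algebraMap k (RatFunField k n) (ρ g⁻¹ 0 0) +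
        algebraMap k (RatFunField k n) (ρ g⁻¹ 0 1) * t
  have hμ : ∀ g : G, ratFunAction k n g (ψ 0) = μ g * ψ 0 := fun g => hmul g 0
  have hμ_inv : ∀ g h : G, ratFunAction k n g (μ h) = μ h := fun g h => by
    simp only [μ]
    rw [map_add, map_mul, AlgEquiv.commutes, AlgEquiv.commutes, ht_inv]
  let χ : G →* RatFunField k n :=
    { toFun := μ
      map_one' := by simp [μ]
      map_mul' := fun g h => by
        apply mul_right_cancel₀ hψ0
        rw [← hμ, Subgroup.coe_mul, map_mul, AlgEquiv.mul_apply, hμ h, map_mul, hμ_inv, hμ g]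
        ring }
  have hχ : μ g₀⁻¹ = 1 :=
    congrArg Units.val (eq_one_of_isPerfect_of_isSolvable χ.toHomUnits g₀⁻¹)
  simp only [μ, inv_inv, hg₀] at hχ
  simp only [Matrix.neg_apply, Matrix.one_apply_eq, Matrix.one_apply_ne (zero_ne_one' (Fin 2)),
    neg_zero, map_zero, zero_mul, add_zero, map_neg, map_one] at hχ
  have h2 : (2 : RatFunField k n) = 0 := by linear_combination -hχ
  have h2' : algebraMap k (RatFunField k n) 2 = algebraMap k (RatFunField k n) 0 := by
    rw [map_ofNat, h2, map_zero]
  exact two_ne_zero ((algebraMap k (RatFunField k n)).injective h2')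

theorem not_isBinaryIcosahedral_of_isSaturated {k : Type*} [Field k] [IsAlgClosed k] [CharZero k]
    {n : ℕ} {G : Subgroup (GL (Fin n) k)} [Finite G] [Group.IsPerfect G]
    (hsat : IsSaturated (invariantSubfield G)) (N : Subgroup G) [N.Normal] :
    ¬ IsBinaryIcosahedral (G ⧸ N) := by
  rintro ⟨A, -, ⟨e⟩⟩
  let B := A.comap (QuotientGroup.mk' (Subgroup.center SL(2, ℂ)))
  let ρ : G ⧸ N →* SL(2, ℂ) := B.subtype.comp e.toMonoidHom
  have hρ : Function.Injective ρ := B.subtype_injective.comp e.injective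
  obtain ⟨σ, -, hσ⟩ := exists_injective_hom_specialLinearGroup k ρ hρ
  have hneg : (-1 : SL(2, ℂ)) ∈ B := by
    have hz : (-1 : SL(2, ℂ)) ∈ Subgroup.center SL(2, ℂ) :=
      Subgroup.mem_center_iff.mpr fun g => by simp
    change QuotientGroup.mk' _ (-1 : SL(2, ℂ)) ∈ A
    have h1 : QuotientGroup.mk' (Subgroup.center SL(2, ℂ)) (-1) = 1 :=
      (QuotientGroup.eq_one_iff _).mpr hz
    rw [h1]
    exact A.one_mem
  obtain ⟨g₀, hg₀⟩ := QuotientGroup.mk_surjective (e.symm ⟨-1, hneg⟩)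
  let τ : G →* Matrix (Fin 2) (Fin 2) k :=
    { toFun := fun g => (σ (g : G ⧸ N)).1
      map_one' := by rw [QuotientGroup.mk_one, map_one]; rfl
      map_mul' := fun x y => by rw [QuotientGroup.mk_mul, map_mul]; rfl }
  refine ne_neg_one_of_isSaturated hsat τ g₀ ?_
  have h1 : ρ (g₀ : G ⧸ N) = -1 := by
    rw [hg₀]
    exact congrArg Subtype.val (e.apply_symm_apply ⟨-1, hneg⟩)
  have h2 := congrArg Subtype.val (hσ _ h1)
  rwa [Matrix.SpecialLinearGroup.coe_neg, Matrix.SpecialLinearGroup.coe_one] at h2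

theorem theorem3 {k : Type*} [Field k] [IsAlgClosed k] [CharZero k] (n : ℕ)
    (G : Subgroup (GL (Fin n) k)) [Finite G] :
    ((∀ (N : Subgroup G) [N.Normal], (∀ a b : G ⧸ N, a * b = b * a) → Subsingleton (G ⧸ N)) ∧
      (∀ (N : Subgroup G) [N.Normal], ¬ IsBinaryIcosahedral (G ⧸ N))) ↔
    IsSaturated (invariantSubfield G) := by
  constructor
  · rintro ⟨hab, hI⟩
    have := isPerfect_of_forall_quotient hab
    exact isSaturated_invariantSubfield G hI
  · intro hsat
    have hab := fun (N : Subgroup G) [N.Normal] => subsingleton_quotient_of_isSaturated hsat N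
    have := isPerfect_of_forall_quotient hab
    exact ⟨hab, fun N _ => not_isBinaryIcosahedral_of_isSaturated hsat N⟩
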